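/- A set $D$ of vertices of a graph is a dominating set if every vertex of the graph belongs to $D$ or has a neighbour in $D$; it is a minimal dominating set if no proper subset of $D$ is a dominating set. Consider a word RAM, on which each arithmetic operation on words, each memory access, each test and each output of one word costs one time unit, and whose words have $O(\log (n+1))$ bits for inputs with $n$ vertices. There are a program for this machine and a constant $C$ such that, for every $n\ge 1$ and every tree $T$ with vertices $0,\dots,n-1$, given as $n$ followed by a list of the edges of $T$ (in arbitrary order, with the two endpoints of each edge in arbitrary order), the program outputs every minimal dominating set of $T$ exactly once (each as a list of its elements without repetition, followed by an end mark) and nothing else, and then halts. The setup time is $O(n)$: the first set is completed after at most $Cn$ time units. The delay is $O(n)$: after the completion of each set, the next set is completed, or, after the last set, the program halts, within at most $Cn$ further time units. -/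

import Mathlib

/-! ### Minimal dominating sets -/

namespace SimpleGraph

/-- `a` dominates `b` if `b = a` or `b` is adjacent to `a`. -/
def Dominates {V : Type*} (G : SimpleGraph V) (a b : V) : Prop :=
  b = a ∨ G.Adj a b

/-- Every vertex is dominated by some element of `D`. -/
def IsDominatingSet {V : Type*} (G : SimpleGraph V) (D : Finset V) : Prop :=
  ∀ b : V, ∃ a ∈ D, G.Dominates a b

/-- A dominating set, no proper subset of which is a dominating set. -/
def IsMinimalDominatingSet {V : Type*} (G : SimpleGraph V) (D : Finset V) : Prop :=
  G.IsDominatingSet D ∧ ∀ D' : Finset V, D' ⊂ D → ¬ G.IsDominatingSet D'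

/-- `L` lists every edge of `G` exactly once, in any order and with its two endpoints
in any order. -/
def IsEdgeList {V : Type*} (G : SimpleGraph V) (L : List (V × V)) : Prop :=
  (L.map fun e => s(e.1, e.2)).Nodup ∧
    ∀ e : Sym2 V, e ∈ L.map (fun e => s(e.1, e.2)) ↔ e ∈ G.edgeSet

end SimpleGraph

/-! ### A word RAM

A finite program acts on registers and on a random-access memory, all of whose cells hold
words, i.e. natural numbers below a bound `W` (the machine has `log₂ W` bits per word).
An operation whose operands or result do not fit into a word cannot be executed.
Every arithmetic operation, memory access, test and output of one word costs one time unit. -/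

namespace WordRAM

/-- Registers and memory. -/
structure State where
  reg : ℕ → ℕ
  mem : ℕ → ℕ

/-- Arithmetic expressions. -/
inductive Expr where
  | lit (k : ℕ)
  | reg (r : ℕ)
  | load (a : Expr)
  | add (a b : Expr)
  | sub (a b : Expr)
  | mul (a b : Expr)
  | lt (a b : Expr)
  | eq (a b : Expr)

namespace Expr

/-- The value of an expression. Subtraction is truncated at `0`, and the comparisons `lt` and
`eq` return `1` if they hold and `0` if not. -/
def val (s : State) : Expr → ℕ
  | lit k => k
  | reg r => s.reg r
  | load a => s.mem (a.val s)
  | add a b => a.val s + b.val s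
  | sub a b => a.val s - b.val s
  | mul a b => a.val s * b.val s
  | lt a b => if a.val s < b.val s then 1 else 0
  | eq a b => if a.val s = b.val s then 1 else 0

/-- The time for evaluating an expression: one unit for each of its nodes. -/
def time : Expr → ℕ
  | lit _ => 1
  | reg _ => 1
  | load a => a.time + 1
  | add a b => a.time + b.time + 1
  | sub a b => a.time + b.time + 1
  | mul a b => a.time + b.time + 1
  | lt a b => a.time + b.time + 1
  | eq a b => a.time + b.time + 1

/-- The values of the expression and of all its subexpressions are below `W`. -/
def Fits (W : ℕ) (s : State) : Expr → Prop
  | lit k => (lit k).val s < W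
  | reg r => (reg r).val s < W
  | load a => a.Fits W s ∧ (load a).val s < W
  | add a b => a.Fits W s ∧ b.Fits W s ∧ (add a b).val s < W
  | sub a b => a.Fits W s ∧ b.Fits W s ∧ (sub a b).val s < W
  | mul a b => a.Fits W s ∧ b.Fits W s ∧ (mul a b).val s < W
  | lt a b => a.Fits W s ∧ b.Fits W s ∧ (lt a b).val s < W
  | eq a b => a.Fits W s ∧ b.Fits W s ∧ (eq a b).val s < W

end Expr

/-- Programs. `write e` writes the word `e` to the output; `endSol` writes a separator,
which completes one solution. -/
inductive Program where
  | skip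
  | assign (r : ℕ) (e : Expr)
  | store (a e : Expr)
  | write (e : Expr)
  | endSol
  | seq (p q : Program)
  | ite (e : Expr) (p q : Program)
  | while (e : Expr) (p : Program)

/-- What happens in one time unit: an internal step, or the output of a word or a separator. -/
inductive Event where
  | step
  | write (v : ℕ)
  | endSol

/-- `k` internal steps. -/
def steps (k : ℕ) : List Event := List.replicate k Event.step

/-- `Exec W p s tr s'`: with words below `W`, the program `p` started in state `s` halts in
state `s'`, and `tr` lists the events of the time units of this execution, in order; thus
`tr.length` is the running time. A test counts as true if its value is not `0`. -/
inductive Exec (W : ℕ) : Program → State → List Event → State → Prop where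
  | skip (s : State) : Exec W .skip s (steps 1) s
  | assign (s : State) (r : ℕ) (e : Expr) (he : e.Fits W s) :
      Exec W (.assign r e) s (steps (e.time + 1))
        { s with reg := Function.update s.reg r (e.val s) }
  | store (s : State) (a e : Expr) (ha : a.Fits W s) (he : e.Fits W s) :
      Exec W (.store a e) s (steps (a.time + e.time + 1))
        { s with mem := Function.update s.mem (a.val s) (e.val s) }
  | write (s : State) (e : Expr) (he : e.Fits W s) :
      Exec W (.write e) s (steps e.time ++ [Event.write (e.val s)]) s
  | endSol (s : State) : Exec W .endSol s [Event.endSol] s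
  | seq {p q : Program} {s s' s'' : State} {t t' : List Event}
      (hp : Exec W p s t s') (hq : Exec W q s' t' s'') :
      Exec W (.seq p q) s (t ++ t') s''
  | iteTrue {e : Expr} {p q : Program} {s s' : State} {t : List Event}
      (he : e.Fits W s) (hv : e.val s ≠ 0) (hp : Exec W p s t s') :
      Exec W (.ite e p q) s (steps (e.time + 1) ++ t) s'
  | iteFalse {e : Expr} {p q : Program} {s s' : State} {t : List Event}
      (he : e.Fits W s) (hv : e.val s = 0) (hq : Exec W q s t s') :
      Exec W (.ite e p q) s (steps (e.time + 1) ++ t) s'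
  | whileTrue {e : Expr} {p : Program} {s s' s'' : State} {t t' : List Event}
      (he : e.Fits W s) (hv : e.val s ≠ 0) (hp : Exec W p s t s')
      (hw : Exec W (.while e p) s' t' s'') :
      Exec W (.while e p) s (steps (e.time + 1) ++ t ++ t') s''
  | whileFalse {e : Expr} {p : Program} {s : State}
      (he : e.Fits W s) (hv : e.val s = 0) :
      Exec W (.while e p) s (steps (e.time + 1)) s

/-- The phases of a run: the stretches of time before the first separator, between
successive separators, and after the last separator. The separators themselves are removed. -/
def phases : List Event → List (List Event)
  | [] => [[]]
  | .endSol :: t => [] :: phases t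
  | x :: t => (phases t).modifyHead (x :: ·)

/-- The words that are written to the output, in order. -/
def written : List Event → List ℕ
  | [] => []
  | .write v :: t => v :: written t
  | _ :: t => written t

/-- The solutions produced in a run: one list of words for each separator. -/
def solutions (tr : List Event) : List (List ℕ) := (phases tr).dropLast.map written

/-- The run `tr` lists the members of the family `F` of sets of numbers: every member
is produced exactly once, written as a list of its elements without repetitions, and
nothing else is produced. -/
def Lists (tr : List Event) (F : Set (Finset ℕ)) : Prop :=
  (∀ l ∈ solutions tr, l.Nodup) ∧
  ((solutions tr).map List.toFinset).Nodup ∧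
  (∀ A : Finset ℕ, A ∈ (solutions tr).map List.toFinset ↔ A ∈ F) ∧
  (∀ p ∈ (phases tr).getLast?, written p = [])

/-- Setup time at most `a`: the first solution is completed (or, if there is none, the
program halts) within time `a`. -/
def SetupTimeLE (tr : List Event) (a : ℕ) : Prop :=
  ∀ p ∈ (phases tr).head?, p.length + 1 ≤ a

/-- Delay at most `b`: after the completion of each solution, the next solution
is completed, or the program halts, within time `b`. -/
def DelayLE (tr : List Event) (b : ℕ) : Prop :=
  ∀ p ∈ (phases tr).tail, p.length + 1 ≤ b

/-- The initial state for a graph with vertices `0, …, n - 1` that is given by a list of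
edges: memory cell `0` contains `n`, the following cells contain the endpoints of
the edges, one edge after the other; everything else is `0`. -/
def initState (n : ℕ) (L : List (Fin n × Fin n)) : State where
  reg := fun _ => 0
  mem := fun i => (n :: L.flatMap fun e => [(e.1 : ℕ), (e.2 : ℕ)]).getD i 0

end WordRAM

namespace WordRAM

/-! ### Symbolic execution of programs without loops and output -/

/-! A dominating set is minimal iff each of its elements has a private neighbour, that is, a vertex
of its closed neighbourhood that is dominated exactly once (`isMinimalDominatingSet_iff`). Give each
vertex two bits: membership in the set, and being dominated exactly once. Correctness of these bits
is a condition on closed neighbourhoods, in which the elements of the set need only be counted up to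
2 and the vertices dominated once only up to 1. So a finite tree automaton recognizes the correct
labellings (`alive_iff`). They correspond bijectively to the minimal dominating sets, since the set
determines the second bit (`alive_ext`).

Root the tree at `0`, put an additional vertex `n` above the root, and order the vertices so that
each precedes its parent. One pass in this order computes, for every vertex, the states that can be
completed in the part of the tree below it. Labels are then chosen in the opposite order, parents
first. The parts still unlabelled are independent of each other, so a partial labelling all of whose
states are completable (`Alive`) can always be extended (`Alive.exists_validLabel`, `Alive.update`).
Hence backtracking meets no dead ends (`completions_ne_nil`). The search tree has depth `n` and at
most four branches per node, so `O(n)` moves separate two solutions (`scan`, `explores`). Each move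
takes constant time, as the finite transition tables are expanded into expressions, and writing a
set takes `O(n)`.

The order is found in linear time without adjacency lists: only the degree of each vertex and the
sum of its neighbours are stored, and the sum at a leaf is its only neighbour. The additional vertex
counts as a neighbour of the root, which is therefore eliminated last (`elim_loop`).

On the machine side, code without loops and output is evaluated symbolically
(`Program.Safe.silent`), the preparatory loops have invariants with a decreasing measure
(`silent_while`), and the trace of the search is composed from pieces described by `Produces`. -/

theorem steps_add (a b : ℕ) : steps a ++ steps b = steps (a + b) := by
  simp [steps]

/-- All registers and memory cells hold words. -/
def State.Bounded (W : ℕ) (s : State) : Prop :=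
  (∀ r, s.reg r < W) ∧ ∀ a, s.mem a < W

/-- What remains to be checked for `Fits` in a bounded state. -/
def Expr.Ok (W : ℕ) (s : State) : Expr → Prop
  | lit k => k < W
  | reg _ => True
  | load a => a.Ok W s
  | add a b => a.Ok W s ∧ b.Ok W s ∧ a.val s + b.val s < W
  | sub a b => a.Ok W s ∧ b.Ok W s
  | mul a b => a.Ok W s ∧ b.Ok W s ∧ a.val s * b.val s < W
  | lt a b => a.Ok W s ∧ b.Ok W s
  | eq a b => a.Ok W s ∧ b.Ok W s

theorem Expr.Fits.val_lt {W : ℕ} {s : State} {e : Expr} (h : e.Fits W s) : e.val s < W := by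
  cases e <;> simp only [Expr.Fits] at h <;> tauto

/-- Only literals, sums and products can overflow in a bounded state: truncated subtraction does not
exceed its first operand, and comparisons return at most `1`, whence `2 ≤ W`. -/
theorem Expr.Ok.fits {W : ℕ} {s : State} (hs : s.Bounded W) (hW : 2 ≤ W) {e : Expr}
    (h : e.Ok W s) : e.Fits W s := by
  induction e with
  | lit k => exact h
  | reg r => exact hs.1 r
  | load a iha => exact ⟨iha h, hs.2 _⟩
  | add a b iha ihb => exact ⟨iha h.1, ihb h.2.1, h.2.2⟩
  | mul a b iha ihb => exact ⟨iha h.1, ihb h.2.1, h.2.2⟩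
  | sub a b iha ihb =>
    exact ⟨iha h.1, ihb h.2, lt_of_le_of_lt (Nat.sub_le _ _) (iha h.1).val_lt⟩
  | lt a b iha ihb =>
    refine ⟨iha h.1, ihb h.2, ?_⟩
    simp only [Expr.val]; split_ifs <;> omega
  | eq a b iha ihb =>
    refine ⟨iha h.1, ihb h.2, ?_⟩
    simp only [Expr.val]; split_ifs <;> omega

namespace Program

/-- The effect of a program without loops and output. -/
def run : Program → State → State
  | assign r e, s => { s with reg := Function.update s.reg r (e.val s) }
  | store a e, s => { s with mem := Function.update s.mem (a.val s) (e.val s) }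
  | seq p q, s => q.run (p.run s)
  | ite e p q, s => if e.val s ≠ 0 then p.run s else q.run s
  | _, s => s

/-- The program can be executed and reaches neither loops nor output commands. -/
def Safe (W : ℕ) : Program → State → Prop
  | skip, _ => True
  | assign _ e, s => e.Ok W s
  | store a e, s => a.Ok W s ∧ e.Ok W s
  | seq p q, s => p.Safe W s ∧ q.Safe W (p.run s)
  | ite e p q, s => e.Ok W s ∧ (e.val s ≠ 0 → p.Safe W s) ∧ (e.val s = 0 → q.Safe W s)
  | _, _ => False

/-- A bound for the running time of a program without loops. -/
def cost : Program → ℕ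
  | assign _ e => e.time + 1
  | store a e => a.time + e.time + 1
  | seq p q => p.cost + q.cost
  | ite e p q => e.time + 1 + p.cost + q.cost
  | _ => 1

end Program

/-- `p` goes from `s` to `s'` without output, within time `T`. -/
def Silent (W : ℕ) (p : Program) (s : State) (T : ℕ) (s' : State) : Prop :=
  ∃ k ≤ T, Exec W p s (steps k) s'

theorem Silent.seq {W : ℕ} {p q : Program} {s s' s'' : State} {T T' : ℕ}
    (h : Silent W p s T s') (h' : Silent W q s' T' s'') :
    Silent W (.seq p q) s (T + T') s'' := by
  obtain ⟨k, hk, h⟩ := h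
  obtain ⟨k', hk', h'⟩ := h'
  exact ⟨k + k', by omega, by rw [← steps_add]; exact .seq h h'⟩

/-- This turns statements about executions into evaluations of `run` and `Safe`, which are mere
simplification. Boundedness persists because every stored value has been checked to fit. -/
theorem Program.Safe.silent {W : ℕ} (hW : 2 ≤ W) {p : Program} {s : State}
    (hs : s.Bounded W) (h : p.Safe W s) :
    Silent W p s p.cost (p.run s) ∧ (p.run s).Bounded W := by
  induction p generalizing s with
  | skip => exact ⟨⟨1, le_rfl, .skip s⟩, hs⟩
  | assign r e =>
    have hf := Expr.Ok.fits hs hW h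
    refine ⟨⟨_, le_rfl, .assign s r e hf⟩, fun r' => ?_, hs.2⟩
    by_cases hr : r' = r
    · subst hr; simpa [Program.run] using hf.val_lt
    · simpa [Program.run, hr] using hs.1 r'
  | store a e =>
    have hf := Expr.Ok.fits hs hW h.2
    refine ⟨⟨_, le_rfl, .store s a e (Expr.Ok.fits hs hW h.1) hf⟩, hs.1, fun x => ?_⟩
    by_cases hr : x = a.val s
    · subst hr; simpa [Program.run] using hf.val_lt
    · simpa [Program.run, hr] using hs.2 x
  | write e => exact h.elim
  | endSol => exact h.elim
  | seq p q ihp ihq =>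
    obtain ⟨h1, h2⟩ := ihp hs h.1
    obtain ⟨h3, h4⟩ := ihq h2 h.2
    exact ⟨h1.seq h3, h4⟩
  | ite e p q ihp ihq =>
    obtain ⟨he, hp, hq⟩ := h
    have hf := Expr.Ok.fits hs hW he
    by_cases hv : e.val s = 0
    · obtain ⟨⟨k, hk, hx⟩, hb⟩ := ihq hs (hq hv)
      simp only [Program.run, hv, ne_eq, not_true_eq_false, if_false, Program.cost]
      exact ⟨⟨e.time + 1 + k, by omega, by rw [← steps_add]; exact .iteFalse hf hv hx⟩, hb⟩
    · obtain ⟨⟨k, hk, hx⟩, hb⟩ := ihp hs (hp hv)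
      simp only [Program.run, hv, ne_eq, not_false_eq_true, if_true, Program.cost]
      exact ⟨⟨e.time + 1 + k, by omega, by rw [← steps_add]; exact .iteTrue hf hv hx⟩, hb⟩
  | _ => exact h.elim

/-- A loop whose body contains neither loops nor output: the first argument of the invariant
bounds the number of iterations that are left. -/
theorem silent_while {W : ℕ} (hW : 2 ≤ W) {e : Expr} {p : Program}
    (I : ℕ → State → Prop) (he : ∀ m s, I m s → e.Ok W s)
    (hp : ∀ m s, I m s → s.Bounded W → e.val s ≠ 0 →
      p.Safe W s ∧ ∃ m' < m, I m' (p.run s)) :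
    ∀ m s, I m s → s.Bounded W →
      ∃ s' m', Silent W (.while e p) s ((e.time + 1 + p.cost) * (m + 1)) s' ∧ I m' s' ∧
        s'.Bounded W ∧ e.val s' = 0 := by
  intro m
  induction m using Nat.strong_induction_on with
  | _ m ih =>
    intro s hI hs
    have hf := Expr.Ok.fits hs hW (he m s hI)
    by_cases hv : e.val s = 0
    · exact ⟨s, m, ⟨e.time + 1, by nlinarith, .whileFalse hf hv⟩, hI, hs, hv⟩
    · obtain ⟨hsafe, m', hm', hI'⟩ := hp m s hI hs hv
      obtain ⟨⟨k, hk, hx⟩, hb⟩ := hsafe.silent hW hs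
      obtain ⟨s', m'', ⟨k', hk', hx'⟩, h1, h2, h3⟩ := ih m' hm' _ hI' hb
      refine ⟨s', m'', ⟨e.time + 1 + k + k', ?_, ?_⟩, h1, h2, h3⟩
      · have : (e.time + 1 + p.cost) * (m' + 1) ≤ (e.time + 1 + p.cost) * m := by gcongr; omega
        nlinarith
      · rw [← steps_add, ← steps_add]
        exact (Exec.whileTrue hf hv hx hx')

/-! ### Finite tables -/

namespace Expr

/-- The expression for `f (e)`, for arguments below `K`. -/
def lookup (f : ℕ → ℕ) (e : Expr) : ℕ → Expr
  | 0 => lit 0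
  | K + 1 => add (lookup f e K) (mul (eq e (lit K)) (lit (f K)))

theorem val_lookup (f : ℕ → ℕ) (e : Expr) (K : ℕ) (s : State) :
    (lookup f e K).val s = if e.val s < K then f (e.val s) else 0 := by
  induction K with
  | zero => simp [lookup, val]
  | succ K ih =>
    simp only [lookup, val, ih]
    rcases lt_trichotomy (e.val s) K with h | h | h
    · simp [h, h.ne, h.trans (Nat.lt_succ_self K)]
    · simp [h]
    · simp [h.ne', h.not_gt, show ¬ e.val s < K + 1 by omega]

theorem ok_lookup {W : ℕ} {s : State} {f : ℕ → ℕ} {e : Expr} {K : ℕ} (he : e.Ok W s)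
    (hW : 0 < W) (hK : K ≤ W) (hf : ∀ i < K, f i < W) : (lookup f e K).Ok W s := by
  induction K with
  | zero => exact hW
  | succ K ih =>
    have hKf := hf K (by omega)
    refine ⟨ih (by omega) fun i hi => hf i (by omega), ⟨⟨he, by exact hK⟩, hKf, ?_⟩, ?_⟩
    · by_cases h : e.val s = K <;> simp [val, h, hKf, hW]
    -- The partial sum is the value of a table again, so it is bounded by a single entry and not by
    -- the sum of all entries.
    · change (lookup f e (K + 1)).val s < W
      rw [val_lookup]
      split_ifs with h
      exacts [hf _ h, hW]

/-- The expression for `f e₁ e₂`, for arguments below `K₁` and `K₂`. -/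
def lookup₂ (f : ℕ → ℕ → ℕ) (e₁ e₂ : Expr) (K₂ : ℕ) : ℕ → Expr
  | 0 => lit 0
  | K + 1 => add (lookup₂ f e₁ e₂ K₂ K) (mul (eq e₁ (lit K)) (lookup (f K) e₂ K₂))

theorem val_lookup₂ (f : ℕ → ℕ → ℕ) (e₁ e₂ : Expr) (K₁ K₂ : ℕ) (s : State) :
    (lookup₂ f e₁ e₂ K₂ K₁).val s =
      if e₁.val s < K₁ ∧ e₂.val s < K₂ then f (e₁.val s) (e₂.val s) else 0 := by
  induction K₁ with
  | zero => simp [lookup₂, val]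
  | succ K ih =>
    simp only [lookup₂, val, ih, val_lookup]
    rcases lt_trichotomy (e₁.val s) K with h | h | h
    · simp [h, h.ne, h.trans (Nat.lt_succ_self K)]
    · simp [h]
    · simp [h.ne', h.not_gt, show ¬ e₁.val s < K + 1 by omega]

theorem ok_lookup₂ {W : ℕ} {s : State} {f : ℕ → ℕ → ℕ} {e₁ e₂ : Expr} {K₁ K₂ : ℕ}
    (h₁ : e₁.Ok W s) (h₂ : e₂.Ok W s) (hW : 0 < W) (hK₁ : K₁ ≤ W) (hK₂ : K₂ ≤ W)
    (hf : ∀ i < K₁, ∀ j < K₂, f i j < W) : (lookup₂ f e₁ e₂ K₂ K₁).Ok W s := by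
  induction K₁ with
  | zero => exact hW
  | succ K ih =>
    have hKf := hf K (by omega)
    refine ⟨ih (by omega) fun i hi => hf i (by omega),
      ⟨⟨h₁, by exact hK₁⟩, ok_lookup h₂ hW hK₂ hKf, ?_⟩, ?_⟩
    · by_cases h : e₁.val s = K
      · simp only [val, val_lookup, h, if_true, one_mul]
        split_ifs with h4
        exacts [hKf _ h4, hW]
      · simp [val, h, hW]
    · change (lookup₂ f e₁ e₂ K₂ (K + 1)).val s < W
      rw [val_lookup₂]
      split_ifs with h
      exacts [hf _ h.1 _ h.2, hW]

end Expr

/-! ### Arrays in memory -/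

/-- The address of entry `i` of array number `j`, where `b` is the address of the first array
entry. -/
def addr (b i j : ℕ) : ℕ := b + (i * 16 + j)

-- The arrays are interleaved in records of 16 cells. Distinct entries never share a cell, so
-- simplification can resolve all memory updates.
@[simp] theorem addr_inj {b i j i' j' : ℕ} (hj : j < 16) (hj' : j' < 16) :
    addr b i j = addr b i' j' ↔ i = i' ∧ j = j' := by
  unfold addr; omega

/-- The address of entry `e` of array number `j`; register `1` holds the address of the first
array entry. -/
def Expr.cell (j : ℕ) (e : Expr) : Expr := .add (.reg 1) (.add (.mul e (.lit 16)) (.lit j))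

@[simp] theorem Expr.val_cell (j : ℕ) (e : Expr) (s : State) :
    (Expr.cell j e).val s = addr (s.reg 1) (e.val s) j := rfl

@[simp] theorem Expr.ok_cell {W j : ℕ} {e : Expr} {s : State} : (Expr.cell j e).Ok W s ↔
    e.Ok W s ∧ 16 < W ∧ s.reg 1 + (e.val s * 16 + j) < W := by
  simp only [Expr.cell, Expr.Ok, Expr.val, true_and]
  refine ⟨fun h => ⟨h.1.1.1, h.1.1.2.1, h.2⟩, fun h => ⟨⟨⟨h.1, h.2.1, ?_⟩, ?_, ?_⟩, h.2.2⟩⟩ <;>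
    omega

end WordRAM

/-! ### Parent functions of trees -/

namespace SimpleGraph

/-- `par` maps each vertex to its parent when the tree `G` on `Fin n` is rooted at `0`; the root
gets the additional vertex `n` as its parent. `dep` is the distance from the root. -/
structure IsParentFun {n : ℕ} (G : SimpleGraph (Fin n)) (par dep : ℕ → ℕ) : Prop where
  par_le : ∀ a < n, par a ≤ n
  par_eq_iff : ∀ a < n, par a = n ↔ a = 0
  adj_iff : ∀ a b : Fin n, G.Adj a b ↔ par a = b ∨ par b = a
  dep_lt : ∀ a < n, par a < n → dep (par a) < dep a

/-- The parent of a vertex is the second vertex of its unique path to the root, and the depth is the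
length of this path; the tail of the path is the path of the parent. -/
theorem IsTree.exists_isParentFun {n : ℕ} {G : SimpleGraph (Fin n)} (hG : G.IsTree) :
    ∃ par dep : ℕ → ℕ, G.IsParentFun par dep := by
  classical
  have hn : 0 < n := (Classical.choice hG.connected.nonempty).pos
  let r : Fin n := ⟨0, hn⟩
  choose p hp hu using fun a : Fin n => hG.existsUnique_path a r
  have hsnd : ∀ a : Fin n, a ≠ r → (p (p a).snd).length < (p a).length ∧ G.Adj a (p a).snd := by
    intro a ha
    have hnil : ¬ (p a).Nil := fun h => ha h.eq
    have htail : (p a).tail = p (p a).snd := hu _ _ (hp a).tail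
    refine ⟨?_, (p a).adj_snd hnil⟩
    rw [← htail]
    have := (p a).length_tail_add_one hnil
    omega
  have hr : ∀ a : Fin n, (a : ℕ) = 0 ↔ a = r := fun a => by
    simp [r, Fin.ext_iff]
  let par : ℕ → ℕ := fun a => if h : a < n then (if a = 0 then n else ((p ⟨a, h⟩).snd : ℕ)) else 0
  have par_val : ∀ a : Fin n, par a = if (a : ℕ) = 0 then n else ((p a).snd : ℕ) := fun a => by
    simp [par]
  refine ⟨par, fun a => if h : a < n then (p ⟨a, h⟩).length else 0, ?_, ?_, ?_, ?_⟩
  · intro a ha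
    rw [par_val ⟨a, ha⟩]
    split_ifs
    exacts [le_rfl, Fin.is_le']
  · intro a ha
    rw [par_val ⟨a, ha⟩]
    have := ((p ⟨a, ha⟩).snd).isLt
    simp only
    split_ifs with h <;> simp [h]
    omega
  · intro a b
    rw [par_val, par_val]
    constructor
    · intro hab
      -- If `b` lies on the path of `a`, acyclicity makes it the second vertex; otherwise prepending
      -- `b` to this path gives the path of `b`.
      by_cases hb : b ∈ (p a).support
      · left
        have h1 := hG.isAcyclic.eq_snd_of_adj_start (hp a) hab hb
        rw [if_neg, ← h1]
        intro h0
        have har := (hr a).1 h0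
        subst har
        have : p r = Walk.nil := (hu r _ Walk.IsPath.nil).symm
        rw [this] at hb
        simp only [Walk.support_nil, List.mem_singleton] at hb
        exact hab.ne hb.symm
      · right
        have h1 : p b = Walk.cons hab.symm (p a) := (hu b _ ((hp a).cons hb)).symm
        rw [if_neg, h1, Walk.snd_cons]
        intro h0
        have hbr := (hr b).1 h0
        apply hb
        rw [hbr]
        exact (p a).end_mem_support
    · have key : ∀ a b : Fin n, (if (a : ℕ) = 0 then n else ((p a).snd : ℕ)) = b → G.Adj a b := by
        intro a b h
        split_ifs at h with h0
        · have := b.isLt; omega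
        · rw [← Fin.ext h]
          exact (hsnd a fun h => h0 ((hr a).2 h)).2
      rintro (h | h)
      · exact key a b h
      · exact (key b a h).symm
  · intro a ha h
    have h0 : ¬ a = 0 := by
      rintro rfl
      rw [par_val ⟨0, ha⟩] at h
      simp at h
    have e : par a = ((p ⟨a, ha⟩).snd : ℕ) := by rw [par_val ⟨a, ha⟩, if_neg h0]
    have e' : (⟨par a, h⟩ : Fin n) = (p ⟨a, ha⟩).snd := Fin.ext e
    have key := (hsnd ⟨a, ha⟩ fun h => h0 ((hr ⟨a, ha⟩).2 h)).1
    rw [← e'] at key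
    simpa only [dif_pos h, dif_pos ha] using key

/-! ### Minimal dominating sets by private neighbours -/

/-- It suffices to consider the removal of a single element `a`. A vertex left undominated by it is
dominated by `a` alone. -/
theorem isMinimalDominatingSet_iff {V : Type*} [DecidableEq V] (G : SimpleGraph V)
    (D : Finset V) :
    G.IsMinimalDominatingSet D ↔ G.IsDominatingSet D ∧
      ∀ a ∈ D, ∃ b, G.Dominates a b ∧ ∀ c ∈ D, G.Dominates c b → c = a := by
  refine and_congr_right fun hD => ⟨fun h a ha => ?_, fun h D' hD' hdom => ?_⟩
  · have := h (D.erase a) (Finset.erase_ssubset ha)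
    simp only [IsDominatingSet, not_forall, not_exists, not_and, Finset.mem_erase] at this
    obtain ⟨b, hb⟩ := this
    have hb' : ∀ c ∈ D, G.Dominates c b → c = a := fun c hc hcb => by
      by_contra hca
      exact hb c ⟨hca, hc⟩ hcb
    obtain ⟨c, hc, hcb⟩ := hD b
    exact ⟨b, hb' c hc hcb ▸ hcb, hb'⟩
  · obtain ⟨a, ha, ha'⟩ := Finset.exists_of_ssubset hD'
    obtain ⟨b, -, hb⟩ := h a ha
    obtain ⟨c, hc, hcb⟩ := hdom b
    exact ha' (hb c (hD'.1 hc) hcb ▸ hc)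

end SimpleGraph

/-! ### A tree automaton for minimal dominating sets

A minimal dominating set `D` is represented by a labelling of the vertices: the label of `a` tells
whether `a ∈ D` and whether `a` is dominated by exactly one element of `D`. -/

namespace TreeDom

/-- `1` for the labels of the elements of the set. -/
def isIn (l : Fin 4) : ℕ := l.val % 2

/-- `1` for the labels of the vertices that are dominated exactly once. -/
def isOnce (l : Fin 4) : ℕ := l.val / 2

theorem isIn_le (l : Fin 4) : isIn l ≤ 1 := by unfold isIn; omega

theorem isOnce_le (l : Fin 4) : isOnce l ≤ 1 := by unfold isOnce; omega

theorem label_ext {l m : Fin 4} (h : isIn l = isIn m) (h' : isOnce l = isOnce m) : l = m := by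
  unfold isIn isOnce at *; omega

theorem exists_label (P R : Prop) : ∃ l : Fin 4, (isIn l = 1 ↔ P) ∧ (isOnce l = 1 ↔ R) := by
  by_cases hP : P <;> by_cases hR : R
  · exact ⟨3, by simp [isIn, isOnce, *]⟩
  · exact ⟨1, by simp [isIn, isOnce, *]⟩
  · exact ⟨2, by simp [isIn, isOnce, *]⟩
  · exact ⟨0, by simp [isIn, isOnce, *]⟩

def cap (c m : ℕ) : Fin (c + 1) := ⟨min m c, by omega⟩

/-- Capping commutes with further additions, so the automaton may forget the exact counts at every
step. -/
theorem cap_add (c m k : ℕ) : cap c ((cap c m : ℕ) + k) = cap c (m + k) := by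
  simp only [cap, Fin.mk.injEq]; omega

/-- The state of a vertex during the labelling of a tree: its label, and the numbers of elements
of the set and of vertices dominated once that have been seen in its closed neighbourhood, counted
up to `2` and `1`. The state of the additional vertex above the root is `none`. -/
abbrev VState := Option (Fin 4 × Fin 3 × Fin 2)

/-- The new state of the parent after its child gets the label `k`. -/
def parentState : VState → Fin 4 → VState
  | none, _ => none
  | some (l, a, b), k => some (l, cap 2 (a + isIn k), cap 1 (b + isOnce k))

/-- The state of a new vertex with label `k`, given the state of its parent. -/
def childState : VState → Fin 4 → VState
  | none, k => some (k, cap 2 (isIn k), cap 1 (isOnce k))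
  | some (l, _, _), k => some (k, cap 2 (isIn k + isIn l), cap 1 (isOnce k + isOnce l))

/-- The states that are admissible when all neighbours have been seen. -/
def Accepted : VState → Prop
  | none => True
  | some (l, a, b) => 1 ≤ a.val ∧ (isOnce l = 1 ↔ a.val = 1) ∧ (isIn l = 1 → b.val = 1)

open Classical in
noncomputable def accepted : Finset VState := Finset.univ.filter Accepted

theorem mem_accepted {q : VState} : q ∈ accepted ↔ Accepted q := by
  simp [accepted]

open Classical in
/-- The states of a vertex from which a further child can be labelled, where `A` and `B` are the
states that allow the parent and the child to be completed. -/
noncomputable def combine (A B : Finset VState) : Finset VState :=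
  Finset.univ.filter fun q => ∃ k, parentState q k ∈ A ∧ childState q k ∈ B

/-- `v` lists the vertices below `n`, each one before its parent. -/
structure IsElimOrder (n : ℕ) (par v : ℕ → ℕ) : Prop where
  lt : ∀ i < n, v i < n
  inj : ∀ i < n, ∀ j < n, v i = v j → i = j
  par : ∀ i < n, par (v i) = n ∨ ∃ j, i < j ∧ j < n ∧ par (v i) = v j

/-- `b` is in the closed neighbourhood of `a`. -/
def Near (par : ℕ → ℕ) (a b : ℕ) : Prop := a = b ∨ par a = b ∨ par b = a

instance (par : ℕ → ℕ) (a : ℕ) : DecidablePred (Near par a) :=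
  fun b => inferInstanceAs (Decidable (a = b ∨ par a = b ∨ par b = a))

section

variable (n : ℕ) (par v : ℕ → ℕ)

/-- The vertices that have a label when the vertices with index `i` or larger are labelled. -/
def labelled (i : ℕ) : Finset ℕ := (Finset.Ico i n).image v

/-- The state of the vertex `u` in this situation, for the labelling `f`. -/
def vstate (f : ℕ → Fin 4) (i u : ℕ) : VState :=
  if u = n then none
  else some (f u, cap 2 (∑ w ∈ labelled n v i with Near par u w, isIn (f w)),
    cap 1 (∑ w ∈ labelled n v i with Near par u w, isOnce (f w)))

/-- The states of `u` that can be completed, using only the part below `u` with indices below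
`i`. -/
noncomputable def completable : ℕ → ℕ → Finset VState
  | 0 => fun _ => accepted
  | i + 1 => Function.update (completable i) (par (v i))
      (combine (completable i (par (v i))) (completable i (v i)))

/-- The label `k` for the vertex with index `i` leads to a partial labelling that can be
completed. -/
def ValidLabel (f : ℕ → Fin 4) (i : ℕ) (k : Fin 4) : Prop :=
  parentState (vstate n par v f (i + 1) (par (v i))) k ∈ completable par v i (par (v i)) ∧
    childState (vstate n par v f (i + 1) (par (v i))) k ∈ completable par v i (v i)

/-- All states are completable. -/
def Alive (f : ℕ → Fin 4) (i : ℕ) : Prop :=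
  ∀ u, u = n ∨ u ∈ labelled n v i → vstate n par v f i u ∈ completable par v i u

open Classical in
/-- All labellings that extend the partial labelling `f`, which is fixed for indices at
least `i`. -/
noncomputable def completions : ℕ → (ℕ → Fin 4) → List (ℕ → Fin 4)
  | 0, f => [f]
  | i + 1, f => (List.finRange 4).flatMap fun k =>
      if ValidLabel n par v f i k then completions i (Function.update f (v i) k) else []

end

/-! ### Extending partial labellings along an elimination order -/

variable {n : ℕ} {par v : ℕ → ℕ}

theorem labelled_eq_insert {i : ℕ} (hi : i < n) :
    labelled n v i = insert (v i) (labelled n v (i + 1)) := by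
  unfold labelled
  rw [← Finset.image_insert, Finset.insert_Ico_add_one_left_eq_Ico hi]

namespace IsElimOrder

theorem notMem_labelled (h : IsElimOrder n par v) {i : ℕ} (hi : i < n) : v i ∉ labelled n v
    (i + 1) := by
  simp only [labelled, Finset.mem_image, Finset.mem_Ico, not_exists, not_and, and_imp]
  intro j hj hjn e
  have := h.inj _ hjn _ hi e
  omega

theorem mem_labelled_lt (h : IsElimOrder n par v) {i u : ℕ} (hu : u ∈ labelled n v i) : u < n := by
  simp only [labelled, Finset.mem_image, Finset.mem_Ico] at hu
  obtain ⟨j, hj, rfl⟩ := hu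
  exact h.lt _ hj.2

theorem labelled_zero (h : IsElimOrder n par v) : labelled n v 0 = Finset.range n := by
  apply Finset.eq_of_subset_of_card_le
  · intro u hu
    exact Finset.mem_range.2 (h.mem_labelled_lt hu)
  · unfold labelled
    rw [Finset.card_image_of_injOn]
    · simp
    · intro i hi j hj
      simp only [Finset.coe_Ico, Set.mem_Ico] at hi hj
      exact h.inj _ hi.2 _ hj.2

theorem par_ne (h : IsElimOrder n par v) {i j : ℕ} (hi : i < n) (hj : j < n) (hij : i ≤ j) : par
    (v j) ≠ v i := by
  intro e
  rcases h.par j hj with h1 | ⟨m, h1, h2, h3⟩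
  · have := h.lt i hi; omega
  · have := h.inj _ hi _ h2 (by rw [← e, h3]); omega

theorem par_mem (h : IsElimOrder n par v) {i : ℕ} (hi : i < n) : par (v i) = n ∨ par
    (v i) ∈ labelled n v (i + 1) := by
  rcases h.par i hi with h1 | ⟨m, h1, h2, h3⟩
  · exact .inl h1
  · exact .inr (Finset.mem_image.2 ⟨m, Finset.mem_Ico.2 ⟨h1, h2⟩, h3.symm⟩)

theorem par_le (h : IsElimOrder n par v) {i : ℕ} (hi : i < n) : par (v i) ≤ n := by
  rcases h.par_mem hi with h1 | h1
  exacts [h1.le, (h.mem_labelled_lt h1).le]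

/-- All children of `v i` precede it, so its set is final from step `i` on. The search can therefore
read the table left by the complete pass. -/
theorem completable_succ_self (h : IsElimOrder n par v) {i j : ℕ} (hi : i < n) (hj : i ≤ j)
    (hjn : j ≤ n) :
    completable par v j (v i) = completable par v i (v i) := by
  induction j, hj using Nat.le_induction with
  | base => rfl
  | succ j hj ih =>
    rw [completable, Function.update_of_ne (h.par_ne hi hjn hj).symm, ih (by omega)]

/-- The children of `v i` are still unlabelled when `v i` gets its label, so its only labelled
neighbour is its parent. All other states remain as they are. -/
theorem sum_near_of_ne (h : IsElimOrder n par v) {i u : ℕ} (hi : i < n)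
    (hu : u ∈ labelled n v (i + 1))
    (hup : u ≠ par (v i)) (g : ℕ → ℕ) :
    ∑ w ∈ labelled n v i with Near par u w, g w =
      ∑ w ∈ labelled n v (i + 1) with Near par u w, g w := by
  rw [labelled_eq_insert hi, Finset.filter_insert, if_neg]
  obtain ⟨j, hj, rfl⟩ := Finset.mem_image.1 hu
  rw [Finset.mem_Ico] at hj
  rintro (e | e | e)
  · have := h.inj _ hj.2 _ hi e; omega
  · exact h.par_ne hi hj.2 (by omega) e
  · exact hup e.symm

theorem sum_near_par (h : IsElimOrder n par v) {i : ℕ} (hi : i < n) (g : ℕ → ℕ) :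
    ∑ w ∈ labelled n v i with Near par (par (v i)) w, g w =
      (∑ w ∈ labelled n v (i + 1) with Near par (par (v i)) w, g w) + g (v i) := by
  rw [labelled_eq_insert hi, Finset.filter_insert,
  if_pos (show Near par _ _ from Or.inr (Or.inr rfl)),
    Finset.sum_insert (fun hm => h.notMem_labelled hi (Finset.mem_filter.1 hm).1), add_comm]

theorem sum_near_self (h : IsElimOrder n par v) {i : ℕ} (hi : i < n) (g : ℕ → ℕ) :
    ∑ w ∈ labelled n v i with Near par (v i) w, g w =
      g (v i) + if par (v i) = n then 0 else g (par (v i)) := by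
  rw [labelled_eq_insert hi, Finset.filter_insert, if_pos (show Near par _ _ from Or.inl rfl),
    Finset.sum_insert (fun hm => h.notMem_labelled hi (Finset.mem_filter.1 hm).1)]
  congr 1
  have key : ∀ w ∈ labelled n v (i + 1), Near par (v i) w ↔ w = par (v i) := by
    intro w hw
    obtain ⟨j, hj, rfl⟩ := Finset.mem_image.1 hw
    rw [Finset.mem_Ico] at hj
    constructor
    · rintro (e | e | e)
      · have := h.inj _ hj.2 _ hi e.symm; omega
      · exact e.symm
      · exact absurd e (h.par_ne hi hj.2 (by omega))
    · intro e
      exact Or.inr (Or.inl e.symm)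
  rw [Finset.filter_congr key, Finset.sum_filter, Finset.sum_ite_eq']
  rcases h.par_mem hi with h1 | h1
  · rw [if_neg, if_pos h1]
    intro h2
    have := h.mem_labelled_lt h2
    omega
  · have := h.mem_labelled_lt h1
    rw [if_pos h1, if_neg (by omega)]

theorem vstate_of_ne (h : IsElimOrder n par v) {i u : ℕ} (hi : i < n)
    (hu : u = n ∨ u ∈ labelled n v (i + 1))
    (hup : u ≠ par (v i)) (f : ℕ → Fin 4) :
    vstate n par v f i u = vstate n par v f (i + 1) u := by
  unfold vstate
  rcases hu with rfl | hu
  · simp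
  · rw [h.sum_near_of_ne hi hu hup, h.sum_near_of_ne hi hu hup]

theorem vstate_par (h : IsElimOrder n par v) {i : ℕ} (hi : i < n) (f : ℕ → Fin 4) :
    vstate n par v f i (par (v i)) =
      parentState (vstate n par v f (i + 1) (par (v i))) (f (v i)) := by
  unfold vstate
  split_ifs
  · rfl
  · simp only [parentState, cap_add, h.sum_near_par hi]

theorem vstate_self (h : IsElimOrder n par v) {i : ℕ} (hi : i < n) (f : ℕ → Fin 4) :
    vstate n par v f i (v i) =
      childState (vstate n par v f (i + 1) (par (v i))) (f (v i)) := by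
  unfold vstate
  rw [if_neg (h.lt i hi).ne, h.sum_near_self hi, h.sum_near_self hi]
  split_ifs
  · rfl
  · rfl

theorem vstate_congr (h : IsElimOrder n par v) {i u : ℕ} (hu : u = n ∨ u ∈ labelled n v i)
    {f g : ℕ → Fin 4}
    (hfg : ∀ w ∈ labelled n v i, f w = g w) :
    vstate n par v f i u = vstate n par v g i u := by
  unfold vstate
  rcases hu with rfl | hu
  · simp
  · rw [hfg u hu]
    congr 5
    all_goals
      apply Finset.sum_congr rfl
      intro w hw
      rw [hfg w (Finset.mem_filter.1 hw).1]

theorem validLabel_congr (h : IsElimOrder n par v) {i : ℕ} (hi : i < n) {f g : ℕ → Fin 4}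
    (hfg : ∀ w ∈ labelled n v (i + 1), f w = g w) {k : Fin 4} :
    ValidLabel n par v f i k ↔ ValidLabel n par v g i k := by
  unfold ValidLabel
  rw [h.vstate_congr (h.par_mem hi) hfg]

theorem update_eq (h : IsElimOrder n par v) {i : ℕ} (hi : i < n) (f : ℕ → Fin 4) (k : Fin 4) :
    ∀ w ∈ labelled n v (i + 1), Function.update f (v i) k w = f w := by
  intro w hw
  rw [Function.update_of_ne]
  rintro rfl
  exact h.notMem_labelled hi hw

/-- The set of the parent at step `i + 1` was built by `combine` precisely so that a state in it
admits a label for `v i`. -/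
theorem Alive.exists_validLabel (h : IsElimOrder n par v) {i : ℕ} (hi : i < n) {f : ℕ → Fin 4}
    (hf : Alive n par v f (i + 1)) : ∃ k, ValidLabel n par v f i k := by
  have := hf _ (h.par_mem hi)
  rw [completable, Function.update_self, combine, Finset.mem_filter] at this
  exact this.2

/-- Only the states of `v i` and of its parent change, and validity of the label is what these two
need. -/
theorem Alive.update (h : IsElimOrder n par v) {i : ℕ} (hi : i < n) {f : ℕ → Fin 4} {k : Fin 4}
    (hf : Alive n par v f (i + 1)) (hk : ValidLabel n par v f i k) :
    Alive n par v (Function.update f (v i) k) i := by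
  have hfu := h.update_eq hi f k
  rw [← h.validLabel_congr hi hfu] at hk
  intro u hu
  by_cases hup : u = par (v i)
  · subst hup
    rw [h.vstate_par hi, Function.update_self]
    exact hk.1
  by_cases huv : u = v i
  · subst huv
    rw [h.vstate_self hi, Function.update_self]
    exact hk.2
  have hu' : u = n ∨ u ∈ labelled n v (i + 1) := by
    rw [labelled_eq_insert hi, Finset.mem_insert] at hu
    tauto
  rw [h.vstate_of_ne hi hu' hup, h.vstate_congr hu' hfu]
  have := hf u hu'
  rwa [completable, Function.update_of_ne hup] at this

theorem Alive.validLabel (h : IsElimOrder n par v) {i : ℕ} (hi : i < n) {f : ℕ → Fin 4}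
    (hf : Alive n par v f i) :
    ValidLabel n par v f i (f (v i)) := by
  unfold ValidLabel
  rw [← h.vstate_par hi, ← h.vstate_self hi]
  refine ⟨hf _ ?_, hf _ ?_⟩
  · rw [labelled_eq_insert hi, Finset.mem_insert]
    have := h.par_mem hi
    tauto
  · rw [labelled_eq_insert hi]
    exact .inr (Finset.mem_insert_self _ _)

/-- Conversely, forgetting the label of `v i` keeps the labelling alive: the forgotten label
witnesses membership in `combine`. -/
theorem Alive.succ (h : IsElimOrder n par v) {i : ℕ} (hi : i < n) {f : ℕ → Fin 4}
    (hf : Alive n par v f i) :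
    Alive n par v f (i + 1) := by
  intro u hu
  rw [completable]
  by_cases hup : u = par (v i)
  · subst hup
    rw [Function.update_self, combine, Finset.mem_filter]
    exact ⟨Finset.mem_univ _, f (v i), Alive.validLabel h hi hf⟩
  · rw [Function.update_of_ne hup, ← h.vstate_of_ne hi hu hup]
    apply hf
    rw [labelled_eq_insert hi, Finset.mem_insert]
    tauto

theorem completions_agree (h : IsElimOrder n par v) {i : ℕ} (hi : i ≤ n) {f g : ℕ → Fin 4}
    (hg : g ∈ completions n par v i f) : (∀ w ∈ labelled n v i, g w = f w) ∧
      ∀ w, n ≤ w → g w = f w := by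
  induction i generalizing f with
  | zero =>
    rw [completions, List.mem_singleton] at hg
    subst hg
    simp
  | succ i ih =>
    simp only [completions, List.mem_flatMap] at hg
    obtain ⟨k, -, hk⟩ := hg
    split_ifs at hk with hv
    · obtain ⟨h1, h2⟩ := ih (by omega) hk
      constructor
      · intro w hw
        rw [h1 w (by rw [labelled_eq_insert hi]; exact Finset.mem_insert_of_mem hw),
          h.update_eq hi f k w hw]
      · intro w hw
        rw [h2 w hw, Function.update_of_ne]
        have := h.lt i hi
        omega
    · simp at hk

theorem completions_alive (h : IsElimOrder n par v) {i : ℕ} (hi : i ≤ n) {f g : ℕ → Fin 4}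
    (hf : Alive n par v f i)
    (hg : g ∈ completions n par v i f) : Alive n par v g 0 := by
  induction i generalizing f with
  | zero =>
    rw [completions, List.mem_singleton] at hg
    exact hg ▸ hf
  | succ i ih =>
    simp only [completions, List.mem_flatMap] at hg
    obtain ⟨k, -, hk⟩ := hg
    split_ifs at hk with hv
    · exact ih (by omega) (Alive.update h hi hf hv) hk
    · simp at hk

/-- Absence of dead ends, on which the bound for the delay rests. -/
theorem completions_ne_nil (h : IsElimOrder n par v) {i : ℕ} (hi : i ≤ n) {f : ℕ → Fin 4}
    (hf : Alive n par v f i) :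
    completions n par v i f ≠ [] := by
  induction i generalizing f with
  | zero => simp [completions]
  | succ i ih =>
    obtain ⟨k, hk⟩ := Alive.exists_validLabel h hi hf
    simp only [completions, ne_eq, List.flatMap_eq_nil_iff, List.mem_finRange, true_implies,
      not_forall]
    exact ⟨k, by rw [if_pos hk]; exact ih (by omega) (Alive.update h hi hf hk)⟩

theorem completions_nodup (h : IsElimOrder n par v) {i : ℕ} (hi : i ≤ n) (f : ℕ → Fin 4) :
    (completions n par v i f).Nodup := by
  induction i generalizing f with
  | zero => simp [completions]
  | succ i ih =>
    rw [completions, List.nodup_flatMap]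
    constructor
    · intro k _
      split_ifs
      exacts [ih (by omega) _, List.nodup_nil]
    · refine List.Pairwise.imp ?_ (List.nodup_finRange 4)
      intro k k' hkk' g hg hg'
      dsimp only at hg hg'
      split_ifs at hg hg'
      · have hvi : v i ∈ labelled n v i := by
          rw [labelled_eq_insert hi]; exact Finset.mem_insert_self _ _
        have h1 := (h.completions_agree (by omega) hg).1 _ hvi
        have h2 := (h.completions_agree (by omega) hg').1 _ hvi
        rw [Function.update_self] at h1 h2
        exact hkk' (h1.symm.trans h2)
      all_goals simp_all

/-- By `Alive.succ` all restrictions of `g` are alive, so the search accepts each label of `g` in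
turn. -/
theorem mem_completions (h : IsElimOrder n par v) {g : ℕ → Fin 4} (hg : Alive n par v g 0) {i : ℕ}
    (hi : i ≤ n)
    {f : ℕ → Fin 4} (hfg : ∀ w ∈ labelled n v i, f w = g w) (hfg' : ∀ w, n ≤ w → f w = g w) :
    g ∈ completions n par v i f := by
  have hal : ∀ i ≤ n, Alive n par v g i := by
    intro i
    induction i with
    | zero => exact fun _ => hg
    | succ i ih => exact fun hi => Alive.succ h hi (ih (by omega))
  induction i generalizing f with
  | zero =>
    rw [completions, List.mem_singleton]
    funext w
    by_cases hw : w < n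
    · exact (hfg w (by rw [h.labelled_zero]; exact Finset.mem_range.2 hw)).symm
    · exact (hfg' w (by omega)).symm
  | succ i ih =>
    rw [completions, List.mem_flatMap]
    refine ⟨g (v i), List.mem_finRange _, ?_⟩
    rw [if_pos]
    · apply ih (by omega)
      · intro w hw
        rw [labelled_eq_insert hi, Finset.mem_insert] at hw
        by_cases e : w = v i
        · subst e; simp
        · rw [Function.update_of_ne e]
          exact hfg w (hw.resolve_left e)
      · intro w hw
        rw [Function.update_of_ne, hfg' w hw]
        have := h.lt i hi
        omega
    · rw [h.validLabel_congr hi hfg]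
      exact Alive.validLabel h hi (hal i (by omega))

end IsElimOrder

end TreeDom

/-! ### Alive labellings and minimal dominating sets -/

namespace TreeDom

variable {n : ℕ} {par dep v : ℕ → ℕ} {G : SimpleGraph (Fin n)}

/-- The set of vertices that is represented by a labelling. -/
def labelledSet (n : ℕ) (f : ℕ → Fin 4) : Finset ℕ :=
  (Finset.range n).filter fun w => isIn (f w) = 1

theorem mem_labelledSet {f : ℕ → Fin 4} {w : ℕ} :
    w ∈ labelledSet n f ↔ w < n ∧ isIn (f w) = 1 := by
  simp [labelledSet]

theorem near_comm {a b : ℕ} : Near par a b ↔ Near par b a := by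
  unfold Near
  rw [eq_comm (a := a) (b := b)]
  tauto

theorem near_iff_dominates (hG : G.IsParentFun par dep) (a b : Fin n) :
    Near par a b ↔ G.Dominates a b := by
  rw [Near, SimpleGraph.Dominates, hG.adj_iff, Fin.ext_iff, eq_comm (a := (a : ℕ)) (b := (b : ℕ))]

theorem sum_isIn_eq_card (f : ℕ → Fin 4) (u : ℕ) :
    ∑ w ∈ Finset.range n with Near par u w, isIn (f w) =
      ((labelledSet n f).filter (Near par u)).card := by
  rw [Finset.card_eq_sum_ones, labelledSet, Finset.filter_filter, Finset.sum_filter,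
    Finset.sum_filter]
  apply Finset.sum_congr rfl
  intro w _
  have := isIn_le (f w)
  by_cases h1 : Near par u w <;> by_cases h2 : isIn (f w) = 1 <;> simp [h1, h2]
  omega

theorem one_le_sum_isOnce {f : ℕ → Fin 4} {u : ℕ} :
    1 ≤ ∑ w ∈ Finset.range n with Near par u w, isOnce (f w) ↔
      ∃ w < n, Near par u w ∧ isOnce (f w) = 1 := by
  rw [Nat.one_le_iff_ne_zero, ne_eq, Finset.sum_eq_zero_iff]
  simp only [Finset.mem_filter, Finset.mem_range, not_forall]
  constructor
  · rintro ⟨w, ⟨h1, h2⟩, h3⟩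
    have := isOnce_le (f w)
    exact ⟨w, h1, h2, by omega⟩
  · rintro ⟨w, h1, h2, h3⟩
    exact ⟨w, ⟨h1, h2⟩, by omega⟩

/-- When everything is labelled, `completable` is `accepted`; its conditions survive capping, as
they only compare counts with 1. -/
theorem IsElimOrder.alive_zero_iff (h : IsElimOrder n par v) {f : ℕ → Fin 4} :
    Alive n par v f 0 ↔ ∀ u < n, 1 ≤ ((labelledSet n f).filter (Near par u)).card ∧
      (isOnce (f u) = 1 ↔ ((labelledSet n f).filter (Near par u)).card = 1) ∧
      (isIn (f u) = 1 → ∃ w < n, Near par u w ∧ isOnce (f w) = 1) := by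
  have key : ∀ u < n, (vstate n par v f 0 u ∈ completable par v 0 u ↔
      1 ≤ ((labelledSet n f).filter (Near par u)).card ∧
      (isOnce (f u) = 1 ↔ ((labelledSet n f).filter (Near par u)).card = 1) ∧
      (isIn (f u) = 1 → ∃ w < n, Near par u w ∧ isOnce (f w) = 1)) := by
    intro u hu
    rw [← one_le_sum_isOnce, completable, mem_accepted, vstate, if_neg hu.ne,
      h.labelled_zero, sum_isIn_eq_card]
    simp only [Accepted, cap]
    generalize ((labelledSet n f).filter (Near par u)).card = c
    generalize ∑ w ∈ Finset.range n with Near par u w, isOnce (f w) = d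
    refine and_congr (by omega) (and_congr (iff_congr Iff.rfl (by omega)) ?_)
    exact imp_congr Iff.rfl (by omega)
  constructor
  · intro hf u hu
    rw [← key u hu]
    exact hf u (.inr (by rw [h.labelled_zero]; exact Finset.mem_range.2 hu))
  · rintro hf u (rfl | hu)
    · simp [completable, vstate, mem_accepted, Accepted]
    · rw [h.labelled_zero, Finset.mem_range] at hu
      exact (key u hu).2 (hf u hu)

/-- The second bit of an alive labelling is forced by the numbers of dominators, so different
labellings give different sets. -/
theorem IsElimOrder.alive_ext (h : IsElimOrder n par v) {f g : ℕ → Fin 4}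
    (hf : Alive n par v f 0) (hg : Alive n par v g 0)
    (hfg : labelledSet n f = labelledSet n g) (w : ℕ) (hw : w < n) : f w = g w := by
  rw [h.alive_zero_iff] at hf hg
  have h1 := (hf w hw).2.1
  have h2 := (hg w hw).2.1
  rw [hfg, ← h2] at h1
  have h3 : isIn (f w) = 1 ↔ isIn (g w) = 1 := by
    have : w ∈ labelledSet n f ↔ w ∈ labelledSet n g := by rw [hfg]
    simpa [mem_labelledSet, hw] using this
  have := isIn_le (f w)
  have := isIn_le (g w)
  have := isOnce_le (f w)
  have := isOnce_le (g w)
  exact label_ext (by omega) (by omega)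

theorem one_le_card_near_iff (hG : G.IsParentFun par dep) (D : Finset (Fin n)) (b : Fin n) :
    1 ≤ ((D.map Fin.valEmbedding).filter (Near par b)).card ↔ ∃ a ∈ D, G.Dominates a b := by
  rw [Nat.one_le_iff_ne_zero, Finset.card_ne_zero, Finset.Nonempty]
  simp only [Finset.mem_filter, Finset.mem_map, Fin.valEmbedding_apply]
  constructor
  · rintro ⟨_, ⟨a, ha, rfl⟩, hab⟩
    exact ⟨a, ha, (near_iff_dominates hG a b).1 (near_comm.1 hab)⟩
  · rintro ⟨a, ha, hab⟩
    exact ⟨a, ⟨a, ha, rfl⟩, near_comm.1 ((near_iff_dominates hG a b).2 hab)⟩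

theorem card_near_eq_one_iff (hG : G.IsParentFun par dep) (D : Finset (Fin n)) (a b : Fin n)
    (ha : a ∈ D) (hab : G.Dominates a b) :
    ((D.map Fin.valEmbedding).filter (Near par b)).card = 1 ↔
      ∀ c ∈ D, G.Dominates c b → c = a := by
  have hmem : ∀ c : Fin n, (c : ℕ) ∈ (D.map Fin.valEmbedding).filter (Near par b) ↔
      c ∈ D ∧ G.Dominates c b := by
    intro c
    rw [Finset.mem_filter, near_comm, near_iff_dominates hG]
    simp [Fin.val_inj]
  rw [Finset.card_eq_one]
  constructor
  · rintro ⟨x, hx⟩ c hc hcb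
    have h1 := (hmem c).2 ⟨hc, hcb⟩
    have h2 := (hmem a).2 ⟨ha, hab⟩
    rw [hx, Finset.mem_singleton] at h1 h2
    exact Fin.ext (h1.trans h2.symm)
  · intro hc
    refine ⟨a, Finset.eq_singleton_iff_unique_mem.2 ⟨(hmem a).2 ⟨ha, hab⟩, fun x hx => ?_⟩⟩
    obtain ⟨c, -, rfl⟩ := Finset.mem_map.1 (Finset.mem_filter.1 hx).1
    have := (hmem c).1 hx
    exact congrArg _ (hc c this.1 this.2)

/-- A vertex dominated exactly once in the closed neighbourhood of an element `a` is a private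
neighbour of `a`, because `a` itself is among its dominators. -/
theorem IsElimOrder.alive_iff (h : IsElimOrder n par v) (hG : G.IsParentFun par dep)
    {f : ℕ → Fin 4} {D : Finset (Fin n)} (hD : labelledSet n f = D.map Fin.valEmbedding) :
    Alive n par v f 0 ↔ G.IsMinimalDominatingSet D ∧ ∀ u < n,
      (isOnce (f u) = 1 ↔ ((labelledSet n f).filter (Near par u)).card = 1) := by
  have hmem : ∀ a : Fin n, isIn (f a) = 1 ↔ a ∈ D := fun a => by
    have : (a : ℕ) ∈ labelledSet n f ↔ (a : ℕ) ∈ D.map Fin.valEmbedding := by rw [hD]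
    simpa [mem_labelledSet, Fin.val_inj] using this
  rw [h.alive_zero_iff, SimpleGraph.isMinimalDominatingSet_iff]
  constructor
  · intro hf
    refine ⟨⟨fun b => ?_, fun a ha => ?_⟩, fun u hu => (hf u hu).2.1⟩
    · rw [← one_le_card_near_iff hG, ← hD]
      exact (hf b b.isLt).1
    · obtain ⟨w, hw, haw, hw1⟩ := (hf a a.isLt).2.2 ((hmem a).2 ha)
      have haw' := (near_iff_dominates hG a ⟨w, hw⟩).1 haw
      refine ⟨⟨w, hw⟩, haw', ?_⟩
      rw [← card_near_eq_one_iff hG D a ⟨w, hw⟩ ha haw', ← hD]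
      exact (hf w hw).2.1.1 hw1
  · rintro ⟨⟨h1, h2⟩, h3⟩ u hu
    refine ⟨?_, h3 u hu, fun hu1 => ?_⟩
    · rw [hD]
      exact (one_le_card_near_iff hG D ⟨u, hu⟩).2 (h1 ⟨u, hu⟩)
    · have huD := (hmem ⟨u, hu⟩).1 hu1
      obtain ⟨b, hb, hb'⟩ := h2 ⟨u, hu⟩ huD
      refine ⟨b, b.isLt, (near_iff_dominates hG ⟨u, hu⟩ b).2 hb, ?_⟩
      rw [h3 b b.isLt, hD]
      exact (card_near_eq_one_iff hG D ⟨u, hu⟩ b huD hb).2 hb'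

/-- The value `0` outside the tree matches the initial labelling of the search, which never changes
labels there; membership in `completions` is equality of functions on all of `ℕ`. -/
theorem exists_labelling (par : ℕ → ℕ) (D : Finset (Fin n)) : ∃ f : ℕ → Fin 4,
    labelledSet n f = D.map Fin.valEmbedding ∧ (∀ w, n ≤ w → f w = 0) ∧
      ∀ u < n, (isOnce (f u) = 1 ↔ ((labelledSet n f).filter (Near par u)).card = 1) := by
  choose f hf1 hf2 using fun u => exists_label (u ∈ D.map Fin.valEmbedding)
    (((D.map Fin.valEmbedding).filter (Near par u)).card = 1)
  have hD : ∀ u ∈ D.map Fin.valEmbedding, u < n := by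
    intro u hu
    obtain ⟨a, -, rfl⟩ := Finset.mem_map.1 hu
    exact a.isLt
  have hS : labelledSet n (fun u => if u < n then f u else 0) = D.map Fin.valEmbedding := by
    ext u
    rw [mem_labelledSet, ← hf1]
    constructor
    · rintro ⟨h1, h2⟩
      simpa [h1] using h2
    · intro h1
      have := hD u ((hf1 u).1 h1)
      simpa [this] using h1
  refine ⟨_, hS, fun w hw => by simp [hw], fun u hu => ?_⟩
  rw [hS, ← hf2]
  simp [hu]

theorem exists_eq_map_val (f : ℕ → Fin 4) :
    ∃ D : Finset (Fin n), labelledSet n f = D.map Fin.valEmbedding := by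
  refine ⟨(labelledSet n f).preimage Fin.val Fin.val_injective.injOn, ?_⟩
  ext u
  simp only [Finset.mem_map, Finset.mem_preimage, Fin.valEmbedding_apply]
  constructor
  · intro hu
    exact ⟨⟨u, (mem_labelledSet.1 hu).1⟩, hu, rfl⟩
  · rintro ⟨a, ha, rfl⟩
    exact ha

end TreeDom

namespace TreeDom

open WordRAM

/-! ### Codes for the elements of finite types -/

/-- A numbering of a finite type, in which `a₀` gets the number `0`. -/
structure Coding (A : Type) (a₀ : A) where
  code : A → ℕ
  decode : ℕ → A
  size : ℕ
  code_lt : ∀ a, code a < size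
  decode_code : ∀ a, decode (code a) = a
  code_zero : code a₀ = 0

-- The code `0` is reserved for `a₀` because memory starts with zeros: untouched cells then stand
-- for the set `accepted` and for the state `none` of the additional vertex, without any
-- initialization.
open Classical in
noncomputable def coding (A : Type) [Fintype A] (a₀ : A) : Coding A a₀ where
  code a := if a = a₀ then 0 else (Fintype.equivFin A a : ℕ) + 1
  decode i := if h : i - 1 < Fintype.card A ∧ i ≠ 0 then (Fintype.equivFin A).symm ⟨i - 1, h.1⟩
    else a₀
  size := Fintype.card A + 1
  code_lt a := by split_ifs <;> simp
  decode_code a := by by_cases h : a = a₀ <;> simp [h]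
  code_zero := by simp

/-- Numberings of the states and of the sets of states. -/
class Codes where
  stateCoding : Coding VState none
  setCoding : Coding (Finset VState) accepted

open Codes

theorem nonempty_codes : Nonempty Codes :=
  ⟨⟨coding VState none, coding (Finset VState) accepted⟩⟩

noncomputable def combineTable [Codes] (i j : ℕ) : ℕ :=
  setCoding.code (combine (setCoding.decode i) (setCoding.decode j))

def parentTable [Codes] (q k : ℕ) : ℕ :=
  stateCoding.code (parentState (stateCoding.decode q) (Fin.ofNat 4 k))

def childTable [Codes] (q k : ℕ) : ℕ :=
  stateCoding.code (childState (stateCoding.decode q) (Fin.ofNat 4 k))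

open Classical in
def memTable [Codes] (q A : ℕ) : ℕ :=
  if stateCoding.decode q ∈ setCoding.decode A then 1 else 0

def inTable (k : ℕ) : ℕ := isIn (Fin.ofNat 4 k)

/-! ### The program

Register `0` holds `n`, register `1` the address of the arrays. The arrays have the numbers
`0`: degrees, `1`: sums of neighbours, `2`: elimination order, `3`: parents in this order,
`4`: completable states of each vertex, `5`: completable states of the parent at each elimination,
`6`: current state of each vertex, `7`: saved states, `8`: labels. -/

/-- Entry `e` of array number `j`. -/
def entry (j : ℕ) (e : Expr) : Expr := .load (.cell j e)

def initProg : Program :=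
  .seq (.assign 0 (.load (.lit 0))) <| .seq (.assign 1 (.add (.reg 0) (.reg 0))) <|
  .seq (.store (.cell 0 (.lit 0)) (.lit 1)) <| .store (.cell 1 (.lit 0)) (.reg 0)

def edgeGuard : Expr := .lt (.add (.reg 2) (.lit 1)) (.reg 0)

/-- Register the endpoints of an edge as neighbours of each other. -/
def edgeBody : Program :=
  .seq (.assign 3 (.load (.add (.mul (.reg 2) (.lit 2)) (.lit 1)))) <|
  .seq (.assign 4 (.load (.add (.mul (.reg 2) (.lit 2)) (.lit 2)))) <|
  .seq (.store (.cell 0 (.reg 3)) (.add (entry 0 (.reg 3)) (.lit 1))) <|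
  .seq (.store (.cell 1 (.reg 3)) (.add (entry 1 (.reg 3)) (.reg 4))) <|
  .seq (.store (.cell 0 (.reg 4)) (.add (entry 0 (.reg 4)) (.lit 1))) <|
  .seq (.store (.cell 1 (.reg 4)) (.add (entry 1 (.reg 4)) (.reg 3))) <|
  .assign 2 (.add (.reg 2) (.lit 1))

def indexGuard : Expr := .lt (.reg 2) (.reg 0)

theorem indexGuard_val {s : State} : indexGuard.val s ≠ 0 ↔ s.reg 2 < s.reg 0 := by
  by_cases h : s.reg 2 < s.reg 0 <;> simp [indexGuard, Expr.val, h]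

theorem indexGuard_ok {W : ℕ} {s : State} : indexGuard.Ok W s := ⟨trivial, trivial⟩

/-- Eliminate the current vertex if it is a leaf and go on with its neighbour, otherwise go on
with the next index. -/
def elimBody : Program :=
  .ite (.eq (entry 0 (.reg 3)) (.lit 1))
    (.seq (.assign 4 (entry 1 (.reg 3))) <|
      .seq (.store (.cell 2 (.reg 5)) (.reg 3)) <| .seq (.store (.cell 3 (.reg 5)) (.reg 4)) <|
      .seq (.assign 5 (.add (.reg 5) (.lit 1))) <|
      .seq (.store (.cell 0 (.reg 3)) (.lit 0)) <|
      .seq (.store (.cell 0 (.reg 4)) (.sub (entry 0 (.reg 4)) (.lit 1))) <|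
      .seq (.store (.cell 1 (.reg 4)) (.sub (entry 1 (.reg 4)) (.reg 3))) <|
      .assign 3 (.reg 4))
    (.seq (.assign 2 (.add (.reg 2) (.lit 1))) <| .assign 3 (.reg 2))

/-- Compute the completable states of the parent of a vertex. -/
noncomputable def combineBody [Codes] : Program :=
  .seq (.assign 3 (entry 2 (.reg 2))) <| .seq (.assign 4 (entry 3 (.reg 2))) <|
  .seq (.store (.cell 5 (.reg 2)) (entry 4 (.reg 4))) <|
  .seq (.store (.cell 4 (.reg 4)) (.lookup₂ combineTable (entry 4 (.reg 4)) (entry 4 (.reg 3))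
    setCoding.size setCoding.size)) <|
  .assign 2 (.add (.reg 2) (.lit 1))

/-! ### Reading the edges -/

/-- The sum of `g` over the neighbours of `x` in the list `l` of edges. -/
def nbrSum (g : ℕ → ℕ) (l : List (ℕ × ℕ)) (x : ℕ) : ℕ :=
  (l.map fun e => (if e.1 = x then g e.2 else 0) + if e.2 = x then g e.1 else 0).sum

theorem nbrSum_take_succ (g : ℕ → ℕ) (l : List (ℕ × ℕ)) (x i : ℕ) (hi : i < l.length) :
    nbrSum g (l.take (i + 1)) x = nbrSum g (l.take i) x +
      ((if l[i].1 = x then g l[i].2 else 0) + if l[i].2 = x then g l[i].1 else 0) := by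
  rw [List.take_succ_eq_append_getElem hi]
  simp only [nbrSum, List.map_append, List.sum_append, List.map_cons, List.map_nil, List.sum_cons,
    List.sum_nil, add_zero]

/-- A crude bound, quadratic when there are fewer than `n` edges; this is why words must hold
numbers of order `(n + 1) ^ 2`. -/
theorem nbrSum_le {g : ℕ → ℕ} {b : ℕ} (hg : ∀ a ≤ b, g a ≤ b + 1) {l : List (ℕ × ℕ)}
    (hl : ∀ e ∈ l, e.1 ≤ b ∧ e.2 ≤ b) (x : ℕ) : nbrSum g l x ≤ l.length * (2 * (b + 1)) := by
  unfold nbrSum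
  refine (List.sum_le_card_nsmul _ (2 * (b + 1)) ?_).trans ?_
  · intro y hy
    obtain ⟨e, he, rfl⟩ := List.mem_map.1 hy
    have h1 := hg _ (hl e he).1
    have h2 := hg _ (hl e he).2
    split_ifs <;> omega
  · simp

/-- The effect of the two successive additions to one array in `edgeBody`. It also covers equal
endpoints, so the invariant need not exclude loops. -/
theorem update_add_update_add (M : ℕ → ℕ) (a b x p q : ℕ) :
    (if x = b then (if b = a then M a + p else M b) + q else if x = a then M a + p else M x) =
      M x + ((if a = x then p else 0) + if b = x then q else 0) := by
  by_cases hxb : x = b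
  · subst hxb
    by_cases hxa : x = a
    · subst hxa; simp; ring
    · simp [hxa, Ne.symm hxa]
  · by_cases hxa : x = a
    · subst hxa; simp [hxb, Ne.symm hxb]
    · simp [hxa, hxb, Ne.symm hxa, Ne.symm hxb]

/-- The summands at `x = 0` come from the additional edge between the root and `n`, which `initProg`
enters. The field `input` persists because the arrays start beyond the cells of the input. -/
structure EdgeInv (n : ℕ) (l : List (ℕ × ℕ)) (m : ℕ) (s : State) : Prop where
  reg0 : s.reg 0 = n
  reg1 : s.reg 1 = 2 * n
  measure : s.reg 2 + m = l.length
  reg5 : s.reg 5 = 0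
  input : ∀ i (h : i < l.length), s.mem (i * 2 + 1) = l[i].1 ∧ s.mem (i * 2 + 2) = l[i].2
  deg : ∀ x, s.mem (addr (2 * n) x 0) =
    (if x = 0 then 1 else 0) + nbrSum (fun _ => 1) (l.take (s.reg 2)) x
  sum : ∀ x, s.mem (addr (2 * n) x 1) =
    (if x = 0 then n else 0) + nbrSum id (l.take (s.reg 2)) x
  zero : ∀ x j, 2 ≤ j → j < 16 → s.mem (addr (2 * n) x j) = 0

theorem edge_loop {n W : ℕ} (hn : 0 < n) (hW : 100 * (n + 1) ^ 2 ≤ W) {l : List (ℕ × ℕ)}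
    (hlen : l.length + 1 = n) (hl : ∀ e ∈ l, e.1 < n ∧ e.2 < n) {s : State}
    (hs : EdgeInv n l l.length s) (hb : s.Bounded W) :
    ∃ s', Silent W (.while edgeGuard edgeBody) s ((edgeGuard.time + 1 + edgeBody.cost) * n) s' ∧
      EdgeInv n l 0 s' ∧ s'.Bounded W := by
  have hW1 : 100 * (n + 1) ≤ W := by nlinarith
  have he : ∀ m s, EdgeInv n l m s → edgeGuard.Ok W s := by
    intro m s h
    have := h.measure
    simp only [edgeGuard, Expr.Ok, Expr.val, and_true, true_and]
    omega
  have hp : ∀ m s, EdgeInv n l m s → s.Bounded W → edgeGuard.val s ≠ 0 →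
      edgeBody.Safe W s ∧ ∃ m' < m, EdgeInv n l m' (edgeBody.run s) := by
    intro m s h hb hv
    have hm := h.measure
    have hi : s.reg 2 < l.length := by
      simp only [edgeGuard, Expr.val, h.reg0] at hv
      split_ifs at hv
      · omega
      · exact absurd rfl hv
    obtain ⟨hin1, hin2⟩ := h.input _ hi
    obtain ⟨he1, he2⟩ := hl _ (List.getElem_mem hi)
    generalize ha : l[s.reg 2].1 = a at hin1 he1
    generalize hb' : l[s.reg 2].2 = b at hin2 he2
    have hr0 := h.reg0
    have hr1 := h.reg1
    have hlt : ∀ e ∈ l.take (s.reg 2), e.1 ≤ n ∧ e.2 ≤ n := fun e he =>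
      ⟨(hl e (List.mem_of_mem_take he)).1.le, (hl e (List.mem_of_mem_take he)).2.le⟩
    have hmul : (l.take (s.reg 2)).length * (2 * (n + 1)) ≤ 2 * (n + 1) ^ 2 := by
      have : (l.take (s.reg 2)).length ≤ n + 1 := by rw [List.length_take]; omega
      nlinarith
    have hsq : n + 1 ≤ (n + 1) ^ 2 := Nat.le_self_pow two_ne_zero _
    have hd : ∀ x, s.mem (addr (2 * n) x 0) + 2 * (n + 1) < W := fun x => by
      have := nbrSum_le (g := fun _ => 1) (b := n) (fun a _ => by omega) hlt x
      rw [h.deg]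
      split_ifs <;> omega
    have hu : ∀ x, s.mem (addr (2 * n) x 1) + 2 * (n + 1) < W := fun x => by
      have := nbrSum_le (g := id) (b := n) (fun a _ => by simp only [id]; omega) hlt x
      rw [h.sum]
      split_ifs <;> omega
    constructor
    · have := hd a
      have := hd b
      have := hu a
      have := hu b
      by_cases hab : b = a
      · simp [edgeBody, Program.Safe, Program.run, Expr.Ok, Expr.val, entry, hin1, hin2, hr1, hab]
        omega
      · simp [edgeBody, Program.Safe, Program.run, Expr.Ok, Expr.val, entry, hin1, hin2, hr1, hab]
        omega
    · refine ⟨m - 1, by omega, ?_⟩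
      simp [edgeBody, Program.run, Expr.val, entry, hin1, hin2, hr1]
      constructor
      · simp [hr0]
      · simp [hr1]
      · simp; omega
      · simp [h.reg5]
      · intro i hi
        have hne1 : ∀ y k, i * 2 + 1 ≠ addr (2 * n) y k := fun y k => by unfold addr; omega
        have hne2 : ∀ y k, i * 2 + 2 ≠ addr (2 * n) y k := fun y k => by unfold addr; omega
        simp [hne1, hne2, h.input i hi]
      · intro x
        simp only [Function.update_self, nbrSum_take_succ _ _ _ _ hi, ha, hb']
        rw [← add_assoc, ← h.deg x]
        simpa [Function.update_apply] using
          update_add_update_add (fun x => s.mem (addr (2 * n) x 0)) a b x 1 1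
      · intro x
        simp only [Function.update_self, nbrSum_take_succ _ _ _ _ hi, ha, hb']
        rw [← add_assoc, ← h.sum x]
        simpa [Function.update_apply] using
          update_add_update_add (fun x => s.mem (addr (2 * n) x 1)) a b x b a
      · intro x j hj hj'
        simp [hj', show j ≠ 0 by omega, show j ≠ 1 by omega, h.zero x j hj hj']

  obtain ⟨s', m', h1, h2, h3, h4⟩ := silent_while (by omega) (EdgeInv n l) he hp _ _ hs hb
  refine ⟨s', hlen ▸ h1, ?_, h3⟩
  have hm : m' = 0 := by
    simp only [edgeGuard, Expr.val, h2.reg0] at h4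
    have := h2.measure
    split_ifs at h4
    omega
  exact hm ▸ h2

end TreeDom

namespace TreeDom

open WordRAM

/-! ### Edge lists of rooted trees -/

variable {n : ℕ} {par dep : ℕ → ℕ} {G : SimpleGraph (Fin n)}

/-- Every vertex except the root accounts for exactly one edge, the one to its parent. -/
theorem map_edges_perm (hG : G.IsParentFun par dep) {L : List (Fin n × Fin n)}
    (hL : G.IsEdgeList L) :
    (L.map fun e => s((e.1 : ℕ), (e.2 : ℕ))).Perm
      (((Finset.range n).erase 0).toList.map fun c => s(c, par c)) := by
  have hmap : (L.map fun e => s((e.1 : ℕ), (e.2 : ℕ))) =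
      (L.map fun e => s(e.1, e.2)).map (Sym2.map Fin.val) := by simp
  have hpar : ∀ c ∈ (Finset.range n).erase 0, c < n ∧ par c < n := fun c hc => by
    rw [Finset.mem_erase, Finset.mem_range] at hc
    have h1 := hG.par_le c hc.2
    have h2 := hG.par_eq_iff c hc.2
    exact ⟨hc.2, by omega⟩
  rw [hmap, List.perm_ext_iff_of_nodup (hL.1.map (Sym2.map.injective Fin.val_injective))]
  · intro e
    simp only [List.mem_map (f := Sym2.map Fin.val), hL.2]
    simp only [List.mem_map, Finset.mem_toList]
    constructor
    · rintro ⟨z, hz, rfl⟩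
      induction z using Sym2.ind with
      | _ a b =>
        rw [SimpleGraph.mem_edgeSet, hG.adj_iff] at hz
        have key : ∀ a b : Fin n, par a = b → (a : ℕ) ∈ (Finset.range n).erase 0 := by
          intro a b hab
          have := hG.par_eq_iff a a.isLt
          have := b.isLt
          simp only [Finset.mem_erase, Finset.mem_range, a.isLt, and_true]
          omega
        rcases hz with hz | hz
        · exact ⟨a, key a b hz, by rw [hz, Sym2.map_mk]⟩
        · exact ⟨b, key b a hz, by rw [hz, Sym2.map_mk, Sym2.eq_swap]⟩
    · rintro ⟨c, hc, rfl⟩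
      obtain ⟨h1, h2⟩ := hpar c hc
      exact ⟨s(⟨c, h1⟩, ⟨par c, h2⟩), by
        rw [SimpleGraph.mem_edgeSet, hG.adj_iff]; exact .inl rfl, by simp⟩
  · refine List.Nodup.map_on ?_ (Finset.nodup_toList _)
    intro c hc d hd hcd
    rw [Finset.mem_toList] at hc hd
    rw [Sym2.eq_iff] at hcd
    rcases hcd with hcd | ⟨h1, h2⟩
    · exact hcd.1
    -- Here `c` and `d` would be parents of each other, against the decrease of the depth.
    · have h3 := hG.dep_lt c (hpar c hc).1 (hpar c hc).2
      have h4 := hG.dep_lt d (hpar d hd).1 (hpar d hd).2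
      rw [h2] at h3
      rw [← h1] at h4
      omega

theorem length_edges (hn : 0 < n) (hG : G.IsParentFun par dep) {L : List (Fin n × Fin n)}
    (hL : G.IsEdgeList L) : L.length + 1 = n := by
  have := (map_edges_perm hG hL).length_eq
  rw [List.length_map, List.length_map, Finset.length_toList,
    Finset.card_erase_of_mem (by simpa using hn), Finset.card_range] at this
  omega

/-- The term for the additional edge is the contribution of the root, so that the root is treated
like any other vertex with a parent. -/
theorem nbrSum_edges (hn : 0 < n) (hG : G.IsParentFun par dep) {L : List (Fin n × Fin n)}
    (hL : G.IsEdgeList L) (g : ℕ → ℕ) {x : ℕ} (hx : x < n) :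
    (if x = 0 then g n else 0) + nbrSum g (L.map fun e => ((e.1 : ℕ), (e.2 : ℕ))) x =
      g (par x) + ∑ c ∈ Finset.range n with par c = x, g c := by
  let F : Sym2 ℕ → ℕ := Sym2.lift ⟨fun a b => (if a = x then g b else 0) + if b = x then g a else 0,
    fun a b => add_comm _ _⟩
  have h1 : nbrSum g (L.map fun e => ((e.1 : ℕ), (e.2 : ℕ))) x =
      ((L.map fun e => s((e.1 : ℕ), (e.2 : ℕ))).map F).sum := by
    simp [nbrSum, F, Function.comp_def]
  have h0 : par 0 = n := (hG.par_eq_iff 0 hn).2 rfl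
  rw [h1, ((map_edges_perm hG hL).map F).sum_eq, List.map_map, Finset.sum_map_toList]
  simp only [Function.comp_def, F, Sym2.lift_mk, Finset.sum_add_distrib]
  rw [← add_assoc, Finset.sum_filter,
    ← Finset.add_sum_erase (Finset.range n) _ (Finset.mem_range.2 hn), h0,
    if_neg (by omega : n ≠ x),
    zero_add, Finset.sum_ite_eq']
  by_cases hx0 : x = 0
  · simp [hx0, h0]
  · simp [hx0, hx]

end TreeDom

namespace TreeDom

open WordRAM

/-! ### The elimination of leaves -/

/-- `R` is the set of vertices that are not yet eliminated. -/
structure ElimInv (n : ℕ) (par : ℕ → ℕ) (R : Finset ℕ) (m : ℕ) (s : State) : Prop where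
  reg0 : s.reg 0 = n
  reg1 : s.reg 1 = 2 * n
  lt : ∀ x ∈ R, x < n
  index_le : s.reg 2 ≤ n
  vertex_le : s.reg 3 ≤ n
  count : s.reg 5 + R.card = n
  measure : s.reg 2 + m = n + R.card
  par_mem : ∀ x ∈ R, par x = n ∨ par x ∈ R
  deg : ∀ x ∈ R, s.mem (addr (2 * n) x 0) = 1 + ∑ c ∈ R with par c = x, 1
  sum : ∀ x ∈ R, s.mem (addr (2 * n) x 1) = par x + ∑ c ∈ R with par c = x, c
  deg_eq_zero : ∀ x ∉ R, s.mem (addr (2 * n) x 0) = 0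
  no_leaf : ∀ x < n, x ≤ s.reg 2 → s.mem (addr (2 * n) x 0) = 1 → x = s.reg 3
  vertex_eq : s.reg 2 = n → s.reg 3 = n
  order : ∀ i < s.reg 5, s.mem (addr (2 * n) i 2) < n ∧ s.mem (addr (2 * n) i 2) ∉ R ∧
    s.mem (addr (2 * n) i 3) = par (s.mem (addr (2 * n) i 2)) ∧
    (par (s.mem (addr (2 * n) i 2)) = n ∨ par (s.mem (addr (2 * n) i 2)) ∈ R ∨
      ∃ j, i < j ∧ j < s.reg 5 ∧ par (s.mem (addr (2 * n) i 2)) = s.mem (addr (2 * n) j 2))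
  inj : ∀ i < s.reg 5, ∀ j < s.reg 5,
    s.mem (addr (2 * n) i 2) = s.mem (addr (2 * n) j 2) → i = j
  zero : ∀ x j, 4 ≤ j → j < 16 → s.mem (addr (2 * n) x j) = 0

theorem sum_erase_children {R : Finset ℕ} {par : ℕ → ℕ} {x : ℕ} (hx : x ∈ R) (g : ℕ → ℕ) (y : ℕ) :
    ∑ c ∈ R with par c = y, g c =
      (if par x = y then g x else 0) + ∑ c ∈ R.erase x with par c = y, g c := by
  rw [Finset.sum_filter, Finset.sum_filter,
    Finset.add_sum_erase R (fun c => if par c = y then g c else 0) hx]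

theorem elimBody_safe {n W : ℕ} (hW : 100 * (n + 1) ≤ W) {par : ℕ → ℕ} {R : Finset ℕ} {m : ℕ}
    {s : State} (h : ElimInv n par R m s) (hi : s.reg 2 < n)
    (hu : s.mem (addr (2 * n) (s.reg 3) 0) = 1 → s.mem (addr (2 * n) (s.reg 3) 1) ≤ n) :
    elimBody.Safe W s := by
  have := h.count
  have := h.vertex_le
  have hr1 := h.reg1
  refine ⟨?_, fun hv => ?_, fun hv => ?_⟩
  · simp [Expr.Ok, Expr.val, entry, hr1]
    omega
  · have hv' : s.mem (addr (2 * n) (s.reg 3) 0) = 1 := by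
      simpa [Expr.val, entry, hr1] using hv
    have := hu hv'
    simp [Program.Safe, Program.run, Expr.Ok, Expr.val, entry, hr1]
    omega
  · simp [Program.Safe, Expr.Ok, Expr.val]
    omega

theorem ElimInv.leaf {n : ℕ} {par : ℕ → ℕ} {R : Finset ℕ} {m : ℕ} {s : State}
    (h : ElimInv n par R m s) {x : ℕ} (hx1 : s.mem (addr (2 * n) x 0) = 1) :
    x ∈ R ∧ (∀ c ∈ R, par c ≠ x) ∧ s.mem (addr (2 * n) x 1) = par x := by
  have hx : x ∈ R := by
    by_contra hx
    have := h.deg_eq_zero x hx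
    omega
  have h1 := h.deg x hx
  have hchild : ∀ c ∈ R, par c ≠ x := by
    intro c hc hcp
    have h2 : ∑ c ∈ R with par c = x, 1 = 0 := by omega
    have := Finset.sum_eq_zero_iff.1 h2 c (Finset.mem_filter.2 ⟨hc, hcp⟩)
    omega
  refine ⟨hx, hchild, ?_⟩
  rw [h.sum x hx, Finset.filter_false_of_mem hchild, Finset.sum_empty, add_zero]

/-- Removing a leaf lowers only the degree of its parent, and the parent becomes the current vertex.
A new leaf is thus handled at once, even if the index has already passed it. -/
theorem elimBody_leaf {n : ℕ} {par : ℕ → ℕ} {R : Finset ℕ} {m : ℕ}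
    {s : State} (h : ElimInv n par R m s) (hi : s.reg 2 < n)
    (hv1 : s.mem (addr (2 * n) (s.reg 3) 0) = 1) :
    ElimInv n par (R.erase (s.reg 3)) (m - 1) (elimBody.run s) := by
  obtain ⟨hv, hnochild, hu⟩ := h.leaf hv1
  have hr1 := h.reg1
  have hcard := Finset.card_erase_add_one hv
  have hcount := h.count
  have hpar := hnochild _ hv
  simp [elimBody, Program.run, Expr.val, entry, hr1, hv1, hu, hpar]
  generalize hx : s.reg 3 = x at *
  have hxn := h.lt x hv
  constructor
  · simp [h.reg0]
  · simp [hr1]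
  · intro y hy
    exact h.lt y (Finset.mem_of_mem_erase hy)
  · simp [hi.le]
  · simp
    rcases h.par_mem x hv with h1 | h1
    exacts [h1.le, (h.lt _ h1).le]
  · simp
    omega
  · have := h.measure
    simp
    omega
  · intro y hy
    rw [Finset.mem_erase] at hy
    rcases h.par_mem y hy.2 with h1 | h1
    · exact .inl h1
    · exact .inr (Finset.mem_erase.2 ⟨hnochild y hy.2, h1⟩)
  · intro y hy
    rw [Finset.mem_erase] at hy
    have h1 := h.deg y hy.2
    rw [sum_erase_children hv] at h1
    by_cases hyp : y = par x
    · subst hyp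
      simp at h1 ⊢
      omega
    · simpa [hyp, hy.1, Ne.symm hyp] using h1
  · intro y hy
    rw [Finset.mem_erase] at hy
    have h1 := h.sum y hy.2
    rw [sum_erase_children hv] at h1
    by_cases hyp : y = par x
    · subst hyp
      simp at h1 ⊢
      omega
    · simpa [hyp, hy.1, Ne.symm hyp] using h1
  · intro y hy
    have h1 := h.deg_eq_zero y
    by_cases hyp : y = par x
    · subst hyp
      have hyR : par x ∉ R := fun h2 => hy (Finset.mem_erase.2 ⟨hpar, h2⟩)
      -- This is the additional vertex `n`; truncated subtraction leaves its degree entry at `0`.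
      simp [h1 hyR]
    · by_cases hyx : y = x
      · subst hyx
        simp [hyp]
      · have hyR : y ∉ R := fun h2 => hy (Finset.mem_erase.2 ⟨hyx, h2⟩)
        simp [hyp, hyx, h1 hyR]
  · intro y hy hyi hy1
    have h1 := h.no_leaf y hy
    by_cases hyp : y = par x
    · simp [hyp]
    · by_cases hyx : y = x
      · subst hyx
        simp [hyp] at hy1
      · simp [hyp, hyx] at hyi hy1
        exact absurd (h1 hyi hy1) (by omega)
  · simp
    omega
  · intro i hi'
    simp at hi' ⊢
    by_cases hic : i = s.reg 5
    · subst hic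
      simp [hxn, hpar]
      exact (h.par_mem x hv).imp_right .inl
    · obtain ⟨h1, h2, h3, h4⟩ := h.order i (by omega)
      simp [hic, h1, h2, h3]
      rcases h4 with h4 | h4 | ⟨j, hj1, hj2, hj3⟩
      · exact .inl h4
      · by_cases e : par (s.mem (addr (2 * n) i 2)) = x
        · exact .inr (.inr ⟨s.reg 5, by omega, le_rfl, by simp [e]⟩)
        · exact .inr (.inl ⟨e, h4⟩)
      · exact .inr (.inr ⟨j, hj1, hj2.le, by simp [hj3, hj2.ne]⟩)
  · intro i hi j hj
    have hne : ∀ i < s.reg 5, s.mem (addr (2 * n) i 2) ≠ x := fun i hi e =>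
      (h.order i hi).2.1 (e ▸ hv)
    simp at hi hj ⊢
    by_cases hic : i = s.reg 5 <;> by_cases hjc : j = s.reg 5
    · simp [hic, hjc]
    · simp [hic, hjc]
      exact fun e => absurd e.symm (hne j (by omega))
    · simp [hic, hjc]
      exact fun e => absurd e (hne i (by omega))
    · simp [hic, hjc]
      exact h.inj i (by omega) j (by omega)
  · intro y j hj hj'
    simp [hj', show j ≠ 0 by omega, show j ≠ 1 by omega, show j ≠ 2 by omega, show j ≠ 3 by omega,
      h.zero y j hj hj']

theorem elimBody_next {n : ℕ} {par : ℕ → ℕ} {R : Finset ℕ} {m : ℕ}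
    {s : State} (h : ElimInv n par R m s) (hi : s.reg 2 < n)
    (hv1 : s.mem (addr (2 * n) (s.reg 3) 0) ≠ 1) :
    ElimInv n par R (m - 1) (elimBody.run s) := by
  have hr1 := h.reg1
  simp [elimBody, Program.run, Expr.val, entry, hr1, hv1]
  constructor
  · simp [h.reg0]
  · simp [hr1]
  · exact h.lt
  · simpa using hi
  · simpa using hi
  · simpa using h.count
  · have := h.measure
    have : R.card ≤ n := by have := h.count; omega
    simp
    omega
  · exact h.par_mem
  · exact h.deg
  · exact h.sum
  · exact h.deg_eq_zero
  · intro y hy hyi hy1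
    simp at hyi hy1 ⊢
    rcases Nat.lt_or_ge (s.reg 2) y with h1 | h1
    · omega
    · have := h.no_leaf y hy h1 hy1
      rw [← this] at hv1
      exact absurd hy1 hv1
  · simp
  · simpa using h.order
  · simpa using h.inj
  · exact h.zero

/-- Each iteration advances the index or removes a vertex, so there are at most `2 * n`. If vertices
were left at the end, a deepest one would have no remaining child and hence degree one. But then
`no_leaf` makes it the current vertex, which is `n` by `vertex_eq`. -/
theorem elim_loop {n W : ℕ} (hW : 100 * (n + 1) ≤ W) {par dep : ℕ → ℕ} {G : SimpleGraph (Fin n)}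
    (hG : G.IsParentFun par dep) {s : State}
    (hs : ElimInv n par (Finset.range n) (2 * n) s) (hb : s.Bounded W) :
    ∃ s', Silent W (.while indexGuard elimBody) s
        ((indexGuard.time + 1 + elimBody.cost) * (2 * n + 1)) s' ∧
      (∃ m, ElimInv n par ∅ m s') ∧ s'.Bounded W := by
  have hp : ∀ m s, (∃ R, ElimInv n par R m s) → s.Bounded W → indexGuard.val s ≠ 0 →
      elimBody.Safe W s ∧ ∃ m' < m, ∃ R, ElimInv n par R m' (elimBody.run s) := by
    rintro m s ⟨R, h⟩ hb hv
    have hi : s.reg 2 < n := by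
      rw [← h.reg0]
      exact indexGuard_val.1 hv
    have hm := h.measure
    refine ⟨elimBody_safe hW h hi fun h1 => ?_, m - 1, by omega, ?_⟩
    · obtain ⟨h2, -, h3⟩ := h.leaf h1
      rw [h3]
      exact hG.par_le _ (h.lt _ h2)
    · by_cases hv1 : s.mem (addr (2 * n) (s.reg 3) 0) = 1
      · exact ⟨_, elimBody_leaf h hi hv1⟩
      · exact ⟨R, elimBody_next h hi hv1⟩
  obtain ⟨s', m', h1, ⟨R, h2⟩, h3, h4⟩ := silent_while (by omega)
    (fun m s => ∃ R, ElimInv n par R m s) (fun _ _ _ => indexGuard_ok) hp _ _ ⟨_, hs⟩ hb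
  refine ⟨s', h1, ⟨m', ?_⟩, h3⟩
  have hi : s'.reg 2 = n := by
    have := h2.index_le
    have : ¬ s'.reg 2 < s'.reg 0 := fun h => indexGuard_val.2 h h4
    have := h2.reg0
    omega
  suffices hR : R = ∅ from hR ▸ h2
  by_contra hR
  obtain ⟨x, hx, hmax⟩ := Finset.exists_max_image R dep (Finset.nonempty_iff_ne_empty.2 hR)
  have hxn := h2.lt x hx
  have hdeg := h2.deg x hx
  rw [Finset.filter_false_of_mem, Finset.sum_empty, add_zero] at hdeg
  · have := h2.no_leaf x hxn (by omega) hdeg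
    have := h2.vertex_eq hi
    omega
  · rintro c hc rfl
    have := hG.dep_lt c (h2.lt c hc) hxn
    have := hmax c hc
    omega

theorem ElimInv.isElimOrder {n : ℕ} {par : ℕ → ℕ} {m : ℕ} {s : State} (h : ElimInv n par ∅ m s) :
    IsElimOrder n par (fun i => s.mem (addr (2 * n) i 2)) := by
  have h5 : s.reg 5 = n := by simpa using h.count
  have ho := h.order
  have hinj := h.inj
  rw [h5] at ho hinj
  refine ⟨fun i hi => (ho i hi).1, hinj, fun i hi => ?_⟩
  simpa using (ho i hi).2.2.2

end TreeDom

namespace TreeDom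

open WordRAM Codes

variable [Codes]

/-! ### Computing the completable states -/

/-- The entry of a parent in array `4` is overwritten for each child. Its previous value is saved in
array `5`, because the search tests a label of `v i` against the set that the parent had before
absorbing `v i`. -/
structure CombineInv (n : ℕ) (par v : ℕ → ℕ) (m : ℕ) (s : State) : Prop where
  reg0 : s.reg 0 = n
  reg1 : s.reg 1 = 2 * n
  measure : s.reg 2 + m = n
  order : ∀ i < n, s.mem (addr (2 * n) i 2) = v i
  parent : ∀ i < n, s.mem (addr (2 * n) i 3) = par (v i)
  done : ∀ u, s.mem (addr (2 * n) u 4) = setCoding.code (completable par v (s.reg 2) u)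
  saved : ∀ i < s.reg 2, s.mem (addr (2 * n) i 5) = setCoding.code (completable par v i (par (v i)))
  zero : ∀ x j, 6 ≤ j → j < 16 → s.mem (addr (2 * n) x j) = 0

theorem combine_loop {n W : ℕ} (hW : 100 * (n + 1) ≤ W) (hW' : setCoding.size ≤ W)
    {par v : ℕ → ℕ} (hv : IsElimOrder n par v) {s : State}
    (hs : CombineInv n par v n s) (hb : s.Bounded W) :
    ∃ s', Silent W (.while indexGuard combineBody) s
        ((indexGuard.time + 1 + combineBody.cost) * (n + 1)) s' ∧
      CombineInv n par v 0 s' ∧ s'.Bounded W := by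
  have hp : ∀ m s, CombineInv n par v m s → s.Bounded W → indexGuard.val s ≠ 0 →
      combineBody.Safe W s ∧ ∃ m' < m, CombineInv n par v m' (combineBody.run s) := by
    intro m s h hb hg
    have hi : s.reg 2 < n := by
      rw [← h.reg0]
      exact indexGuard_val.1 hg
    have hr1 := h.reg1
    have hm := h.measure
    have h2 := h.order _ hi
    have h3 := h.parent _ hi
    have hvlt := hv.lt _ hi
    have hple := hv.par_le hi
    have hlt := setCoding.code_lt
    constructor
    · have hok : ∀ {s'} {e₁ e₂ : Expr}, e₁.Ok W s' → e₂.Ok W s' →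
          (Expr.lookup₂ combineTable e₁ e₂ setCoding.size setCoding.size).Ok W s' :=
        fun h₁ h₂ => Expr.ok_lookup₂ h₁ h₂ (by omega) hW' hW'
          fun i _ j _ => (setCoding.code_lt _).trans_le hW'
      refine ⟨?_, ?_, ?_, ⟨?_, hok ?_ ?_⟩, ?_⟩ <;>
        simp [Program.Safe, Program.run, Expr.Ok, Expr.val, entry, hr1, h2, h3] <;> omega
    · refine ⟨m - 1, by omega, ?_⟩
      simp [combineBody, Program.run, Expr.val, entry, hr1, h2, h3, Expr.val_lookup₂, h.done,
        setCoding.code_lt, combineTable, setCoding.decode_code]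
      constructor
      · simp [h.reg0]
      · simp [hr1]
      · simp; omega
      · intro i hi
        simp [h.order i hi]
      · intro i hi
        simp [h.parent i hi]
      · intro u
        by_cases hu : u = par (v (s.reg 2)) <;> simp [hu, h.done, completable]
      · intro i hi
        by_cases hu : i = s.reg 2
        · simp [hu]
        · simp at hi
          simp [hu, h.saved i (by omega)]
      · intro x j hj hj'
        simp [hj', show j ≠ 4 by omega, show j ≠ 5 by omega, h.zero x j hj hj']
  obtain ⟨s', m', h1, h2, h3, h4⟩ := silent_while (by omega)
    (CombineInv n par v) (fun _ _ _ => indexGuard_ok) hp _ _ hs hb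
  have hm : m' = 0 := by
    have : ¬ s'.reg 2 < s'.reg 0 := fun h => indexGuard_val.2 h h4
    have := h2.reg0
    have := h2.measure
    omega
  exact ⟨s', h1, hm ▸ h2, h3⟩

end TreeDom

namespace WordRAM

/-! ### Traces that produce solutions -/

/-- The run `tr` produces the solutions `ls`: the first one within time `a`, each further one
within time `g` after the preceding one, and after the last one it takes time at most `b`. -/
def Produces (g b : ℕ) : ℕ → List (List ℕ) → List Event → Prop
  | _, [], tr => ∃ k ≤ b, tr = steps k
  | a, l :: ls, tr => ∃ c tr', tr = c ++ Event.endSol :: tr' ∧ Event.endSol ∉ c ∧ written c = l ∧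
      c.length + 1 ≤ a ∧ Produces g b g ls tr'

theorem endSol_notMem_steps (k : ℕ) : Event.endSol ∉ steps k := by
  simp [steps, List.mem_replicate]

theorem length_steps (k : ℕ) : (steps k).length = k := List.length_replicate

theorem written_steps_append (k : ℕ) (c : List Event) : written (steps k ++ c) = written c := by
  induction k with
  | zero => rfl
  | succ k ih => exact ih

theorem written_steps (k : ℕ) : written (steps k) = [] := by
  simpa [written] using written_steps_append k []

theorem written_append (c d : List Event) : written (c ++ d) = written c ++ written d := by
  induction c with
  | nil => rfl
  | cons x c ih => cases x <;> simp [written, ih]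

theorem Produces.mono {g b b' a a' : ℕ} {ls : List (List ℕ)} {tr : List Event}
    (h : Produces g b a ls tr) (ha : a ≤ a') (hb : b ≤ b') : Produces g b' a' ls tr := by
  induction ls generalizing a a' tr with
  | nil =>
    obtain ⟨k, hk, rfl⟩ := h
    exact ⟨k, hk.trans hb, rfl⟩
  | cons l ls ih =>
    obtain ⟨c, tr', h1, h2, h3, h4, h5⟩ := h
    exact ⟨c, tr', h1, h2, h3, h4.trans ha, ih h5 le_rfl⟩

theorem Produces.steps_append {g b a : ℕ} {ls : List (List ℕ)} {tr : List Event}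
    (h : Produces g b a ls tr) (hls : ls ≠ []) (k : ℕ) :
    Produces g b (k + a) ls (steps k ++ tr) := by
  cases ls with
  | nil => exact absurd rfl hls
  | cons l ls =>
    obtain ⟨c, tr', h1, h2, h3, h4, h5⟩ := h
    refine ⟨steps k ++ c, tr', by rw [h1, List.append_assoc], ?_, ?_, ?_, h5⟩
    · rw [List.mem_append, not_or]
      exact ⟨endSol_notMem_steps k, h2⟩
    · rw [written_steps_append, h3]
    · rw [List.length_append, length_steps]
      omega

theorem Produces.append_steps {g b a : ℕ} {ls : List (List ℕ)} {tr : List Event}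
    (h : Produces g b a ls tr) (k : ℕ) : Produces g (b + k) a ls (tr ++ steps k) := by
  induction ls generalizing a tr with
  | nil =>
    obtain ⟨k', hk, rfl⟩ := h
    exact ⟨k' + k, by omega, steps_add _ _⟩
  | cons l ls ih =>
    obtain ⟨c, tr', h1, h2, h3, h4, h5⟩ := h
    exact ⟨c, tr' ++ steps k, by rw [h1, List.append_assoc, List.cons_append], h2, h3, h4, ih h5⟩

/-- The end of the first piece and the beginning of the second merge into a single gap. Both lists
must be nonempty, as otherwise a piece would only lengthen a neighbouring gap. -/
theorem Produces.append {g b b' a a' : ℕ} {ls ls' : List (List ℕ)} {tr tr' : List Event}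
    (h : Produces g b a ls tr) (hls : ls ≠ []) (h' : Produces g b' a' ls' tr') (hls' : ls' ≠ [])
    (hg : b + a' ≤ g) : Produces g b' a (ls ++ ls') (tr ++ tr') := by
  induction ls generalizing a tr with
  | nil => exact absurd rfl hls
  | cons l ls ih =>
    obtain ⟨c, t, h1, h2, h3, h4, h5⟩ := h
    refine ⟨c, t ++ tr', by rw [h1, List.append_assoc, List.cons_append], h2, h3, h4, ?_⟩
    by_cases hl : ls = []
    · subst hl
      obtain ⟨k, hk, rfl⟩ := h5
      exact (h'.steps_append hls' k).mono (by omega) le_rfl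
    · exact ih h5 hl

theorem phases_of_notMem {c : List Event} (hc : Event.endSol ∉ c) : phases c = [c] := by
  induction c with
  | nil => rfl
  | cons x c ih =>
    rw [List.mem_cons, not_or] at hc
    cases x with
    | endSol => exact absurd rfl hc.1
    | _ => simp [phases, ih hc.2]

theorem phases_append_endSol {c tr : List Event} (hc : Event.endSol ∉ c) :
    phases (c ++ Event.endSol :: tr) = c :: phases tr := by
  induction c with
  | nil => rfl
  | cons x c ih =>
    rw [List.mem_cons, not_or] at hc
    cases x with
    | endSol => exact absurd rfl hc.1
    | _ => simp [phases, ih hc.2]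

theorem Produces.exists_phases {g b a : ℕ} {ls : List (List ℕ)} {tr : List Event}
    (h : Produces g b a ls tr) : ∃ ps k, k ≤ b ∧ phases tr = ps ++ [steps k] ∧
      ps.map written = ls ∧ (∀ p ∈ ps.head?, p.length + 1 ≤ a) ∧
      ∀ p ∈ ps.tail, p.length + 1 ≤ g := by
  induction ls generalizing a tr with
  | nil =>
    obtain ⟨k, hk, rfl⟩ := h
    exact ⟨[], k, hk, phases_of_notMem (endSol_notMem_steps k), by simp⟩
  | cons l ls ih =>
    obtain ⟨c, t, rfl, h2, h3, h4, h5⟩ := h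
    obtain ⟨ps, k, hk, hp, hm, hh, ht⟩ := ih h5
    refine ⟨c :: ps, k, hk, by rw [phases_append_endSol h2, hp, List.cons_append],
      by simp [h3, hm], by simpa using h4, ?_⟩
    rw [List.tail_cons]
    intro p hp
    cases ps with
    | nil => simp at hp
    | cons q ps =>
      rcases List.mem_cons.1 hp with rfl | hp
      · exact hh _ rfl
      · exact ht p hp

theorem Produces.lists {g b a : ℕ} {ls : List (List ℕ)} {tr : List Event}
    (h : Produces g b a ls tr) {F : Set (Finset ℕ)} (h1 : ∀ l ∈ ls, l.Nodup)
    (h2 : (ls.map List.toFinset).Nodup) (h3 : ∀ A, A ∈ ls.map List.toFinset ↔ A ∈ F) :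
    Lists tr F := by
  obtain ⟨ps, k, -, hp, hm, -⟩ := h.exists_phases
  have hs : solutions tr = ls := by rw [solutions, hp, List.dropLast_concat, hm]
  refine ⟨by rwa [hs], by rwa [hs], by rwa [hs], ?_⟩
  rw [hp, List.getLast?_concat]
  rintro _ ⟨⟩
  exact written_steps k

theorem Produces.setupTimeLE {g b a : ℕ} {ls : List (List ℕ)} {tr : List Event}
    (h : Produces g b a ls tr) (hls : ls ≠ []) : SetupTimeLE tr a := by
  obtain ⟨ps, k, -, hp, hm, hh, -⟩ := h.exists_phases
  cases ps with
  | nil => exact absurd hm.symm hls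
  | cons p ps => simpa [SetupTimeLE, hp] using hh

theorem Produces.delayLE {g b a : ℕ} {ls : List (List ℕ)} {tr : List Event}
    (h : Produces g b a ls tr) (hls : ls ≠ []) (hb : b + 1 ≤ g) : DelayLE tr g := by
  obtain ⟨ps, k, hk, hp, hm, -, ht⟩ := h.exists_phases
  cases ps with
  | nil => exact absurd hm.symm hls
  | cons p ps =>
    intro q hq
    rw [hp, List.cons_append, List.tail_cons, List.mem_append, List.mem_singleton] at hq
    rcases hq with hq | rfl
    · exact ht q hq
    · rw [length_steps]
      omega

/-! ### Iterations of a loop -/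

/-- Some iterations of the loop with test `e` and body `p` lead from `s` to `s'`. -/
inductive Iterates (W : ℕ) (e : Expr) (p : Program) : State → List Event → State → Prop
  | refl (s : State) : Iterates W e p s [] s
  | step {s s' s'' : State} {t t' : List Event} (he : e.Fits W s) (hv : e.val s ≠ 0)
      (hp : Exec W p s t s') (hw : Iterates W e p s' t' s'') :
      Iterates W e p s (steps (e.time + 1) ++ t ++ t') s''

/-- The recursive exploration is run by one flat loop, so its recursive calls are consecutive
stretches of iterations. -/
theorem Iterates.trans {W : ℕ} {e : Expr} {p : Program} {s s' s'' : State} {t t' : List Event}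
    (h : Iterates W e p s t s') (h' : Iterates W e p s' t' s'') :
    Iterates W e p s (t ++ t') s'' := by
  induction h with
  | refl => exact h'
  | step he hv hp _ ih =>
    rw [List.append_assoc]
    exact .step he hv hp (ih h')

theorem Iterates.exec {W : ℕ} {e : Expr} {p : Program} {s s' : State} {t : List Event}
    (h : Iterates W e p s t s') (he : e.Fits W s') (hv : e.val s' = 0) :
    Exec W (.while e p) s (t ++ steps (e.time + 1)) s' := by
  induction h with
  | refl => exact .whileFalse he hv
  | step he' hv' hp _ ih =>
    rw [List.append_assoc]
    exact .whileTrue he' hv' hp (ih he hv)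

theorem Program.Safe.iterates {W : ℕ} (hW : 2 ≤ W) {e : Expr} {p : Program} {s : State}
    (hs : s.Bounded W) (he : e.Ok W s) (hv : e.val s ≠ 0) (h : p.Safe W s) :
    (∃ k ≤ e.time + 1 + p.cost, Iterates W e p s (steps k) (p.run s)) ∧
      (p.run s).Bounded W := by
  obtain ⟨⟨k, hk, hx⟩, hb⟩ := h.silent hW hs
  refine ⟨⟨e.time + 1 + k, by omega, ?_⟩, hb⟩
  have := Iterates.step (he.fits hs hW) hv hx (.refl _)
  rwa [List.append_nil, steps_add] at this

end WordRAM

namespace TreeDom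

open WordRAM Codes

/-! ### The search for the minimal dominating sets -/

/-- Register `6` holds the number of vertices without label, register `7` the next label to be
tried. -/
def searchGuard : Expr := .lt (.add (.eq (.reg 6) (.reg 0)) (.eq (.reg 7) (.lit 4))) (.lit 2)

def outBody : Program :=
  .seq (.ite (.lookup inTable (entry 8 (.reg 2)) 4) (.write (.reg 2)) .skip) <|
  .assign 2 (.add (.reg 2) (.lit 1))

def outProg : Program :=
  .seq (.assign 2 (.lit 0)) <| .seq (.while indexGuard outBody) <| .endSol

/-- Undo the last choice of a label. -/
def upProg : Program :=
  .seq (.assign 3 (entry 2 (.reg 6))) <| .seq (.assign 4 (entry 3 (.reg 6))) <|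
  .seq (.store (.cell 6 (.reg 4)) (entry 7 (.reg 6))) <|
  .seq (.assign 7 (.add (entry 8 (.reg 3)) (.lit 1))) <| .assign 6 (.add (.reg 6) (.lit 1))

/-- Try the label in register `7` for the next vertex. -/
def tryProg [Codes] : Program :=
  .seq (.assign 9 (.sub (.reg 6) (.lit 1))) <|
  .seq (.assign 3 (entry 2 (.reg 9))) <| .seq (.assign 4 (entry 3 (.reg 9))) <|
  .seq (.assign 8 (entry 6 (.reg 4))) <|
  .seq (.assign 10 (.lookup₂ parentTable (.reg 8) (.reg 7) 4 stateCoding.size)) <|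
  .seq (.assign 11 (.lookup₂ childTable (.reg 8) (.reg 7) 4 stateCoding.size)) <|
  .ite (.mul
      (.lookup₂ memTable (.reg 10) (entry 5 (.reg 9)) setCoding.size stateCoding.size)
      (.lookup₂ memTable (.reg 11) (entry 4 (.reg 3)) setCoding.size stateCoding.size))
    (.seq (.store (.cell 7 (.reg 9)) (.reg 8)) <| .seq (.store (.cell 8 (.reg 3)) (.reg 7)) <|
      .seq (.store (.cell 6 (.reg 3)) (.reg 11)) <| .seq (.store (.cell 6 (.reg 4)) (.reg 10)) <|
      .seq (.assign 6 (.reg 9)) <| .assign 7 (.lit 0))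
    (.assign 7 (.add (.reg 7) (.lit 1)))

def searchBody [Codes] : Program :=
  .seq (.ite (.eq (.reg 6) (.lit 0)) outProg .skip) <|
  .ite (.add (.eq (.reg 6) (.lit 0)) (.eq (.reg 7) (.lit 4))) upProg tryProg

/-- The state `s` represents the partial labelling `f`, in which the vertices with index at least
`i` have labels. -/
structure Node [Codes] (n : ℕ) (par v : ℕ → ℕ) (f : ℕ → Fin 4) (i : ℕ) (s : State) : Prop where
  reg0 : s.reg 0 = n
  reg1 : s.reg 1 = 2 * n
  level : s.reg 6 = i
  order : ∀ i < n, s.mem (addr (2 * n) i 2) = v i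
  parent : ∀ i < n, s.mem (addr (2 * n) i 3) = par (v i)
  compl : ∀ u < n, s.mem (addr (2 * n) u 4) = setCoding.code (completable par v n u)
  complParent : ∀ i < n,
    s.mem (addr (2 * n) i 5) = setCoding.code (completable par v i (par (v i)))
  state : ∀ u, u = n ∨ u ∈ labelled n v i →
    s.mem (addr (2 * n) u 6) = stateCoding.code (vstate n par v f i u)
  saved : ∀ j, i ≤ j → j < n →
    s.mem (addr (2 * n) j 7) = stateCoding.code (vstate n par v f (j + 1) (par (v j)))
  label : ∀ u ∈ labelled n v i, s.mem (addr (2 * n) u 8) = f u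

variable {n W : ℕ} {par v : ℕ → ℕ} {f : ℕ → Fin 4} {i : ℕ} {s : State}

theorem labelled_anti {i j : ℕ} (hij : i ≤ j) : labelled n v j ⊆ labelled n v i :=
  Finset.image_subset_image (Finset.Ico_subset_Ico_left hij)

variable [Codes]

/-- Labels of unlabelled vertices are irrelevant; after a choice for `v i` has been undone, the
state again represents the labelling before the choice. -/
theorem Node.congr (hv : IsElimOrder n par v) (h : Node n par v f i s) {g : ℕ → Fin 4}
    (hfg : ∀ w ∈ labelled n v i, f w = g w) : Node n par v g i s := by
  refine { h with state := ?_, saved := ?_, label := ?_ }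
  · intro u hu
    rw [h.state u hu, hv.vstate_congr hu hfg]
  · intro j hj hjn
    rw [h.saved j hj hjn, hv.vstate_congr (hv.par_mem hjn) fun w hw =>
      hfg w (labelled_anti (by omega) hw)]
  · intro u hu
    rw [h.label u hu, hfg u hu]

theorem up_safe (hW : 100 * (n + 1) ≤ W) (hv : IsElimOrder n par v) (h : Node n par v f i s)
    (hi : i < n) : upProg.Safe W s := by
  have hr1 := h.reg1
  have hvi : v i ∈ labelled n v i := by
    rw [labelled_eq_insert hi]; exact Finset.mem_insert_self _ _
  have h1 := hv.lt i hi
  have h2 := hv.par_le hi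
  simp [upProg, Program.Safe, Program.run, Expr.Ok, Expr.val, entry, hr1, h.level, h.order i hi,
    h.parent i hi, h.label _ hvi]
  omega

/-- Capped counts cannot be decremented, so the state of the parent is restored from array `7`. The
states of the other remaining vertices were not affected by the choice. -/
theorem up_run (hv : IsElimOrder n par v) (h : Node n par v f i s) (hi : i < n) :
    Node n par v f (i + 1) (upProg.run s) ∧ (upProg.run s).reg 7 = f (v i) + 1 := by
  have hr1 := h.reg1
  have hvi : v i ∈ labelled n v i := by
    rw [labelled_eq_insert hi]; exact Finset.mem_insert_self _ _
  simp [upProg, Program.run, Expr.val, entry, hr1, h.level, h.order i hi,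
    h.parent i hi, h.label _ hvi]
  constructor
  · simp [h.reg0]
  · simp [hr1]
  · simp
  · simpa using h.order
  · simpa using h.parent
  · simpa using h.compl
  · simpa using h.complParent
  · intro u hu
    by_cases hup : u = par (v i)
    · subst hup
      simp [h.saved i le_rfl hi]
    · simp [hup]
      rw [h.state u (hu.imp_right fun h => labelled_anti (Nat.le_succ i) h),
        hv.vstate_of_ne hi hu hup]
  · intro j hj hjn
    simp [h.saved j (by omega) hjn]
  · intro u hu
    simp [h.label u (labelled_anti (Nat.le_succ i) hu)]

end TreeDom

namespace TreeDom

open WordRAM Codes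

variable {n W : ℕ} {par v : ℕ → ℕ} {f : ℕ → Fin 4} {i : ℕ} {s : State}

/-! ### The output of a solution -/

/-- The elements of the set that is represented by a labelling, in increasing order. -/
def elements (n : ℕ) (f : ℕ → Fin 4) : List ℕ :=
  (List.range n).filter fun w => isIn (f w) = 1

theorem inTable_val (k : Fin 4) : inTable k = isIn k := by
  simp [inTable]

theorem out_loop (hW : 100 * (n + 1) ≤ W) (m : ℕ) : ∀ s : State, s.Bounded W → s.reg 0 = n →
    s.reg 1 = 2 * n → s.reg 2 + m = n → (∀ w < n, s.mem (addr (2 * n) w 8) = f w) →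
    ∃ c, Exec W (.while indexGuard outBody) s c { s with reg := Function.update s.reg 2 n } ∧
      Event.endSol ∉ c ∧
      written c = (List.range' (s.reg 2) m).filter (fun w => isIn (f w) = 1) ∧
      c.length ≤ (indexGuard.time + 1 + outBody.cost + 1) * (m + 1) := by
  induction m with
  | zero =>
    intro s hb h0 h1 h2 hl
    have hs : { s with reg := Function.update s.reg 2 n } = s := by
      rw [← (show s.reg 2 = n by omega), Function.update_eq_self]
    rw [hs]
    refine ⟨_, .whileFalse (indexGuard_ok.fits hb (by omega)) ?_, endSol_notMem_steps _, ?_, ?_⟩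
    · by_contra hv
      have := indexGuard_val.1 hv
      omega
    · simp [written_steps]
    · rw [length_steps]
      omega
  | succ m ih =>
    intro s hb h0 h1 h2 hl
    have hg : indexGuard.val s ≠ 0 := indexGuard_val.2 (by omega)
    have hgf : indexGuard.Fits W s := indexGuard_ok.fits hb (by omega)
    have hlab := hl (s.reg 2) (by omega)
    have hlook : (Expr.lookup inTable (entry 8 (.reg 2)) 4).val s = isIn (f (s.reg 2)) := by
      rw [Expr.val_lookup]
      simp [entry, Expr.val, h1, hlab, inTable_val]
    have hok : (Expr.lookup inTable (entry 8 (.reg 2)) 4).Fits W s := by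
      refine Expr.Ok.fits hb (by omega) (Expr.ok_lookup ?_ (by omega) (by omega) fun k _ => ?_)
      · simp [entry, Expr.Ok, Expr.val, h1]
        omega
      · exact (isIn_le _).trans_lt (by omega)
    have hassign : Program.Safe W (.assign 2 (.add (.reg 2) (.lit 1))) s := by
      simp [Program.Safe, Expr.Ok, Expr.val]
      omega
    obtain ⟨⟨k, hk, hx⟩, hb'⟩ := hassign.silent (by omega) hb
    obtain ⟨c, hc1, hc2, hc3, hc4⟩ :=
      ih _ hb' (by simp [Program.run, h0]) (by simp [Program.run, h1])
      (by simp [Program.run, Expr.val]; omega) (by simpa [Program.run] using hl)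
    simp only [Program.run, Expr.val, Function.update_idem, Function.update_self] at hc1 hc3
    have hmul : (indexGuard.time + 1 + outBody.cost + 1) * (m + 1 + 1) =
      (indexGuard.time + 1 + outBody.cost + 1) * (m + 1) +
        (indexGuard.time + 1 + outBody.cost + 1) := by ring
    -- `Program.cost` counts `write` as one unit although two are needed here; the unit counted for
    -- the unused branch `skip` makes up for it.
    have hcost : outBody.cost = (Expr.lookup inTable (entry 8 (.reg 2)) 4).time + 1 + 1 + 1 +
      Program.cost (.assign 2 (.add (.reg 2) (.lit 1))) := rfl
    rw [List.range'_succ, List.filter_cons]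
    by_cases hin : isIn (f (s.reg 2)) = 1
    · refine ⟨_, .whileTrue hgf hg (.seq (.iteTrue hok (by omega)
        (.write s (.reg 2) (hb.1 2))) hx) hc1, ?_, ?_, ?_⟩
      · simp [hc2, endSol_notMem_steps]
      · simp only [written_append, written_steps, hc3, hin, Expr.val]
        simp [written]
      · simp only [List.length_append, length_steps, List.length_singleton, Expr.time]
        omega
    · have hz : isIn (f (s.reg 2)) = 0 := by
        have := isIn_le (f (s.reg 2))
        omega
      refine ⟨_, .whileTrue hgf hg (.seq (.iteFalse hok (by omega) (.skip s)) hx) hc1, ?_, ?_, ?_⟩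
      · simp [hc2, endSol_notMem_steps]
      · simp only [written_append, written_steps, hc3]
        simp [hz]
      · simp only [List.length_append, length_steps]
        omega

/-! ### The choice of a label -/

variable [Codes]

theorem parentTable_code (q : VState) (k : Fin 4) :
    parentTable (stateCoding.code q) k = stateCoding.code (parentState q k) := by
  simp [parentTable, stateCoding.decode_code]

theorem childTable_code (q : VState) (k : Fin 4) :
    childTable (stateCoding.code q) k = stateCoding.code (childState q k) := by
  simp [childTable, stateCoding.decode_code]

open Classical in
theorem memTable_code (q : VState) (A : Finset VState) :
    memTable (stateCoding.code q) (setCoding.code A) = if q ∈ A then 1 else 0 := by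
  simp [memTable, stateCoding.decode_code, setCoding.decode_code]

theorem memTable_le (i j : ℕ) : memTable i j ≤ 1 := by
  unfold memTable
  split_ifs <;> omega

theorem try_safe (hW : 100 * (n + 1) ≤ W) (hW₁ : stateCoding.size ≤ W) (hW₂ : setCoding.size ≤ W)
    (hv : IsElimOrder n par v) (h : Node n par v f (i + 1) s) (hi : i < n) {k : Fin 4}
    (hk : s.reg 7 = k) : tryProg.Safe W s := by
  have hr1 := h.reg1
  have h1 := hv.lt i hi
  have h2 := hv.par_le hi
  have hstate : ∀ {g : ℕ → ℕ → ℕ} {s' : State} {e₁ e₂ : Expr},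
      (∀ a b, g a b < stateCoding.size) → e₁.Ok W s' → e₂.Ok W s' →
      (Expr.lookup₂ g e₁ e₂ 4 stateCoding.size).Ok W s' := fun hg h₁ h₂ =>
    Expr.ok_lookup₂ h₁ h₂ (by omega) hW₁ (by omega) fun a _ b _ => (hg a b).trans_le hW₁
  have hmem : ∀ {s' : State} {e₁ e₂ : Expr}, e₁.Ok W s' → e₂.Ok W s' →
      (Expr.lookup₂ memTable e₁ e₂ setCoding.size stateCoding.size).Ok W s' := fun h₁ h₂ =>
    Expr.ok_lookup₂ h₁ h₂ (by omega) hW₁ hW₂ fun a _ b _ => (memTable_le a b).trans_lt (by omega)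
  have hmul : ∀ {s' : State} {e₁ e₂ e₃ e₄ : Expr},
      (Expr.lookup₂ memTable e₁ e₂ setCoding.size stateCoding.size).val s' *
        (Expr.lookup₂ memTable e₃ e₄ setCoding.size stateCoding.size).val s' < W := by
    intro s' e₁ e₂ e₃ e₄
    have hle : ∀ e₁ e₂ : Expr,
        (Expr.lookup₂ memTable e₁ e₂ setCoding.size stateCoding.size).val s' ≤ 1 := by
      intro e₁ e₂
      rw [Expr.val_lookup₂]
      split_ifs
      exacts [memTable_le _ _, zero_le_one]
    exact (Nat.mul_le_mul (hle e₁ e₂) (hle e₃ e₄)).trans_lt (by omega)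
  refine ⟨?_, ?_, ?_, ?_, hstate (fun _ _ => stateCoding.code_lt _) trivial trivial,
    hstate (fun _ _ => stateCoding.code_lt _) trivial trivial,
    ⟨hmem trivial ?_, hmem trivial ?_, hmul⟩, fun _ => ?_, fun _ => ?_⟩ <;>
    simp [Program.Safe, Program.run, Expr.Ok, Expr.val, entry, hr1, h.level, h.order i hi,
      h.parent i hi, hk] <;> omega

theorem try_run_of_valid (hv : IsElimOrder n par v) (h : Node n par v f (i + 1) s) (hi : i < n)
    {k : Fin 4} (hk : s.reg 7 = k) (hval : ValidLabel n par v f i k) :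
    Node n par v (Function.update f (v i) k) i (tryProg.run s) ∧ (tryProg.run s).reg 7 = 0 := by
  have hr1 := h.reg1
  have hq := h.state _ (hv.par_mem hi)
  have hc := h.compl _ (hv.lt i hi)
  have hne := hv.par_ne hi hi le_rfl
  have hfu := hv.update_eq hi f k
  have hvp : vstate n par v f (i + 1) (par (v i)) =
      vstate n par v (Function.update f (v i) k) (i + 1) (par (v i)) :=
    (hv.vstate_congr (hv.par_mem hi) hfu).symm
  -- The final table entry of `v i` is the set at step `i`, so the test in the program is
  -- `ValidLabel`.
  rw [hv.completable_succ_self hi hi.le le_rfl] at hc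
  obtain ⟨hval1, hval2⟩ := hval
  simp [tryProg, Program.run, Expr.val, entry, hr1, h.level, h.order i hi, h.parent i hi, hk, hq,
    Expr.val_lookup₂, stateCoding.code_lt, setCoding.code_lt, parentTable_code, childTable_code,
    memTable_code, hc, h.complParent i hi, hval1, hval2]
  constructor
  · simp [h.reg0]
  · simp [hr1]
  · simp
  · simpa using h.order
  · simpa using h.parent
  · simpa using h.compl
  · simpa using h.complParent
  · intro u hu
    by_cases hup : u = par (v i)
    · subst hup
      simp [hv.vstate_par hi, hvp]
    by_cases huv : u = v i
    · subst huv
      simp [hv.vstate_self hi, hvp, hup]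
    have hu' : u = n ∨ u ∈ labelled n v (i + 1) := by
      rw [labelled_eq_insert hi, Finset.mem_insert] at hu
      tauto
    simp [hup, huv]
    rw [h.state u hu', hv.vstate_of_ne hi hu' hup, hv.vstate_congr hu' hfu]
  · intro j hj hjn
    by_cases hji : j = i
    · subst hji
      simp [hvp]
    · simp [hji]
      rw [h.saved j (by omega) hjn, hv.vstate_congr (hv.par_mem hjn) fun w hw =>
        (hfu w (labelled_anti (by omega) hw)).symm]
  · intro u hu
    by_cases huv : u = v i
    · simp [huv]
    · have hu' : u ∈ labelled n v (i + 1) := by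
        rw [labelled_eq_insert hi, Finset.mem_insert] at hu
        tauto
      simp [huv, h.label u hu']

theorem try_run_of_not_valid (hv : IsElimOrder n par v) (h : Node n par v f (i + 1) s) (hi : i < n)
    {k : Fin 4} (hk : s.reg 7 = k) (hval : ¬ ValidLabel n par v f i k) :
    Node n par v f (i + 1) (tryProg.run s) ∧ (tryProg.run s).reg 7 = k + 1 := by
  have hr1 := h.reg1
  have hq := h.state _ (hv.par_mem hi)
  have hc := h.compl _ (hv.lt i hi)
  rw [hv.completable_succ_self hi hi.le le_rfl] at hc
  rw [ValidLabel, not_and] at hval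
  have hrun : tryProg.run s = Program.run (.seq (.assign 9 (.sub (.reg 6) (.lit 1))) <|
      .seq (.assign 3 (entry 2 (.reg 9))) <| .seq (.assign 4 (entry 3 (.reg 9))) <|
      .seq (.assign 8 (entry 6 (.reg 4))) <|
      .seq (.assign 10 (.lookup₂ parentTable (.reg 8) (.reg 7) 4 stateCoding.size)) <|
      .seq (.assign 11 (.lookup₂ childTable (.reg 8) (.reg 7) 4 stateCoding.size)) <|
      .assign 7 (.add (.reg 7) (.lit 1))) s := by
    simp [tryProg, Program.run, Expr.val, entry, hr1, h.level, h.order i hi, h.parent i hi, hk, hq,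
      Expr.val_lookup₂, stateCoding.code_lt, setCoding.code_lt, parentTable_code, childTable_code,
      memTable_code, hc, h.complParent i hi]
    exact fun h1 h2 => absurd h1 (hval h2)
  rw [hrun]
  -- A failed try changes only registers that `Node` does not mention.
  refine ⟨⟨h.reg0, h.reg1, h.level, h.order, h.parent, h.compl, h.complParent, h.state, h.saved,
    h.label⟩, ?_⟩
  simp [Program.run, Expr.val, hk]

end TreeDom

namespace TreeDom

open WordRAM Codes

variable {n W : ℕ} {par v : ℕ → ℕ} {f : ℕ → Fin 4} {i : ℕ} {s : State}

/-! ### The search loop -/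

/-- A bound for the time of one iteration of the search loop, not counting output. -/
def iterCost [Codes] : ℕ := searchGuard.time + 1 + searchBody.cost

/-- A bound for the time of the output of a solution. -/
def outCost [Codes] (n : ℕ) : ℕ :=
  iterCost + (indexGuard.time + 1 + outBody.cost + 1) * (n + 1)

/-- A bound for the time between two solutions. -/
def gapCost [Codes] (n : ℕ) : ℕ := outCost n + iterCost * (12 * n + 12)

theorem searchGuard_ok (hW : 100 ≤ W) : searchGuard.Ok W s := by
  simp only [searchGuard, Expr.Ok, Expr.val, true_and]
  refine ⟨⟨by omega, ?_⟩, by omega⟩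
  by_cases h1 : s.reg 6 = s.reg 0 <;> by_cases h2 : s.reg 7 = 4 <;> simp [h1, h2] <;> omega

theorem searchGuard_val_ne (h : ¬ (s.reg 6 = s.reg 0 ∧ s.reg 7 = 4)) : searchGuard.val s ≠ 0 := by
  by_cases h1 : s.reg 6 = s.reg 0 <;> by_cases h2 : s.reg 7 = 4 <;>
    simp_all [searchGuard, Expr.val]

theorem searchGuard_val_eq (h6 : s.reg 6 = s.reg 0) (h7 : s.reg 7 = 4) : searchGuard.val s = 0 := by
  simp [searchGuard, Expr.val, h6, h7]

open Classical in
/-- The solutions that are found from a partial labelling with the labels `k`, `k + 1`, … for the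
next vertex. -/
noncomputable def solutionsFrom (n : ℕ) (par v : ℕ → ℕ) (f : ℕ → Fin 4) (i k : ℕ) :
    List (List ℕ) :=
  ((List.finRange 4).drop k).flatMap fun k =>
    if ValidLabel n par v f i k then
      (completions n par v i (Function.update f (v i) k)).map (elements n) else []

theorem solutionsFrom_zero : solutionsFrom n par v f i 0 =
    (completions n par v (i + 1) f).map (elements n) := by
  rw [solutionsFrom, List.drop_zero, completions, List.map_flatMap]
  congr 1
  funext k
  split_ifs <;> rfl

open Classical in
theorem solutionsFrom_succ (k : Fin 4) : solutionsFrom n par v f i k =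
    (if ValidLabel n par v f i k then
      (completions n par v i (Function.update f (v i) k)).map (elements n) else []) ++
      solutionsFrom n par v f i (k + 1) := by
  rw [solutionsFrom, List.drop_eq_getElem_cons (by simp), List.flatMap_cons, List.getElem_finRange]
  simp [solutionsFrom]

theorem solutionsFrom_four : solutionsFrom n par v f i 4 = [] := by
  rw [solutionsFrom, List.drop_eq_nil_of_le (by simp), List.flatMap_nil]

variable [Codes]

/-- An iteration in which the label in register `7` is tried. -/
theorem iterate_try (hW : 100 * (n + 1) ≤ W) (hW₁ : stateCoding.size ≤ W)
    (hW₂ : setCoding.size ≤ W) (hv : IsElimOrder n par v) (hb : s.Bounded W)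
    (h : Node n par v f (i + 1) s) (hi : i < n) {k : Fin 4} (hk : s.reg 7 = k) :
    (∃ m ≤ iterCost, Iterates W searchGuard searchBody s (steps m) (tryProg.run s)) ∧
      (tryProg.run s).Bounded W := by
  have h6 := h.level
  have hk4 := k.isLt
  have hs : Program.run (.ite (.eq (.reg 6) (.lit 0)) outProg .skip) s = s := by
    rw [Program.run, if_neg]
    · rfl
    · simp [Expr.val, h6]
  have hval : Expr.val s (.add (.eq (.reg 6) (.lit 0)) (.eq (.reg 7) (.lit 4))) = 0 := by
    simp [Expr.val, h6, show s.reg 7 ≠ 4 by omega]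
  have hrun : searchBody.run s = tryProg.run s := by
    rw [searchBody, Program.run, hs, Program.run, if_neg (by rw [hval]; simp)]
  rw [← hrun]
  unfold iterCost
  refine Program.Safe.iterates (by omega) hb (searchGuard_ok (by omega))
    (searchGuard_val_ne fun h => by omega) ?_
  have hsafe := try_safe hW hW₁ hW₂ hv h hi hk
  rw [searchBody, Program.Safe, Program.Safe]
  refine ⟨⟨⟨trivial, by change 0 < W; omega⟩, fun h => ?_, fun _ => trivial⟩, ?_⟩
  · simp [Expr.val, h6] at h
  · rw [hs]
    refine ⟨?_, fun h => absurd hval h, fun _ => hsafe⟩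
    refine ⟨⟨trivial, ?_⟩, ⟨trivial, ?_⟩, ?_⟩
    · change 0 < W; omega
    · change 4 < W; omega
    · change Expr.val s (.add (.eq (.reg 6) (.lit 0)) (.eq (.reg 7) (.lit 4))) < W
      omega

theorem up_ite_safe (hW : 100 * (n + 1) ≤ W) (hv : IsElimOrder n par v)
    (h : Node n par v f i s) (hi : i < n) (hup : i = 0 ∨ s.reg 7 = 4) :
    Program.Safe W (.ite (.add (.eq (.reg 6) (.lit 0)) (.eq (.reg 7) (.lit 4))) upProg tryProg) s ∧
      Program.run (.ite (.add (.eq (.reg 6) (.lit 0)) (.eq (.reg 7) (.lit 4))) upProg tryProg) s =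
        upProg.run s := by
  have h6 := h.level
  have hval : Expr.val s (.add (.eq (.reg 6) (.lit 0)) (.eq (.reg 7) (.lit 4))) ≠ 0 := by
    by_cases h1 : i = 0 <;> by_cases h2 : s.reg 7 = 4 <;> simp [Expr.val, h6, h1, h2]
    tauto
  refine ⟨⟨?_, fun _ => up_safe hW hv h hi, fun h => absurd h hval⟩, ?_⟩
  · simp only [Expr.Ok, Expr.val, true_and]
    refine ⟨by omega, by omega, ?_⟩
    by_cases h1 : s.reg 6 = 0 <;> by_cases h2 : s.reg 7 = 4 <;> simp [h1, h2] <;> omega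
  · rw [Program.run, if_pos hval]

/-- An iteration in which all labels have been tried. -/
theorem iterate_up (hW : 100 * (n + 1) ≤ W) (hv : IsElimOrder n par v) (hb : s.Bounded W)
    (h : Node n par v f i s) (hi : i < n) (hi0 : i ≠ 0) (hk : s.reg 7 = 4) :
    (∃ m ≤ iterCost, Iterates W searchGuard searchBody s (steps m) (upProg.run s)) ∧
      (upProg.run s).Bounded W := by
  have h6 := h.level
  have h0 := h.reg0
  obtain ⟨hsafe, hrun'⟩ := up_ite_safe hW hv h hi (.inr hk)
  have hs : Program.run (.ite (.eq (.reg 6) (.lit 0)) outProg .skip) s = s := by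
    rw [Program.run, if_neg]
    · rfl
    · simp [Expr.val, h6, hi0]
  have hrun : searchBody.run s = upProg.run s := by
    rw [searchBody, Program.run, hs, hrun']
  rw [← hrun]
  unfold iterCost
  refine Program.Safe.iterates (by omega) hb (searchGuard_ok (by omega))
    (searchGuard_val_ne fun h => by omega) ?_
  rw [searchBody, Program.Safe, Program.Safe]
  refine ⟨⟨⟨trivial, by change 0 < W; omega⟩, fun h => ?_, fun _ => trivial⟩, ?_⟩
  · simp [Expr.val, h6, hi0] at h
  · rw [hs]
    exact hsafe

/-- An iteration in which a solution is written. -/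
theorem iterate_out (hW : 100 * (n + 1) ≤ W) (hv : IsElimOrder n par v) (hb : s.Bounded W)
    (hn : 0 < n) (h : Node n par v f 0 s) (g : ℕ) :
    ∃ tr s', Iterates W searchGuard searchBody s tr s' ∧ s'.Bounded W ∧
      Node n par v f 1 s' ∧ s'.reg 7 = f (v 0) + 1 ∧
      Produces g iterCost (outCost n) [elements n f] tr := by
  have h6 := h.level
  have h0 := h.reg0
  have hr1 := h.reg1
  have hlab : ∀ w < n, s.mem (addr (2 * n) w 8) = f w := fun w hw =>
    h.label w (by rw [hv.labelled_zero]; exact Finset.mem_range.2 hw)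
  have hassign : Program.Safe W (.assign 2 (.lit 0)) s := by
    simp [Program.Safe, Expr.Ok]
    omega
  obtain ⟨⟨k, hk, hx⟩, hb'⟩ := hassign.silent (by omega) hb
  obtain ⟨c, hc1, hc2, hc3, hc4⟩ := out_loop (f := f) hW n _ hb' (by simp [Program.run, h0])
    (by simp [Program.run, hr1]) (by simp [Program.run, Expr.val])
    (by simpa [Program.run] using hlab)
  simp only [Program.run, Expr.val, Function.update_idem, Function.update_self] at hc1 hc3
  set s₁ : State := { s with reg := Function.update s.reg 2 n } with hs₁
  have hb₁ : s₁.Bounded W := by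
    refine ⟨fun r => ?_, hb.2⟩
    by_cases hr : r = 2
    · subst hr
      simp only [hs₁, Function.update_self]
      omega
    · simpa [hs₁, hr] using hb.1 r
  have hnode : Node n par v f 0 s₁ := ⟨h.reg0, h.reg1, h.level, h.order, h.parent, h.compl,
    h.complParent, h.state, h.saved, h.label⟩
  obtain ⟨hsafe, hrun⟩ := up_ite_safe hW hv hnode hn (.inl rfl)
  obtain ⟨⟨k', hk', hx'⟩, hb''⟩ := hsafe.silent (by omega) hb₁
  obtain ⟨hnode', h7⟩ := up_run hv hnode hn
  rw [hrun] at hx' hb''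
  have hfits : Expr.Fits W s (.eq (.reg 6) (.lit 0)) := Expr.Ok.fits hb (by omega)
    ⟨trivial, by change 0 < W; omega⟩
  have hval : Expr.val s (.eq (.reg 6) (.lit 0)) ≠ 0 := by simp [Expr.val, h6]
  have hexec : Exec W searchBody s _ _ :=
    .seq (.iteTrue hfits hval (.seq hx (.seq hc1 (.endSol s₁)))) hx'
  refine ⟨_, _, .step ((searchGuard_ok (by omega)).fits hb (by omega))
    (searchGuard_val_ne fun h => by omega) hexec (.refl _), hb'', hnode', h7, ?_⟩
  -- The output loop counts as one unit in `cost`; its true running time is the second summand of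
  -- `outCost`.
  have hcost : searchBody.cost = (Expr.eq (.reg 6) (.lit 0)).time + 1 +
    (Program.cost (.assign 2 (.lit 0)) + (1 + 1)) + 1 + Program.cost (.ite
      (.add (.eq (.reg 6) (.lit 0)) (.eq (.reg 7) (.lit 4))) upProg tryProg) := by
    simp only [searchBody, outProg, Program.cost]
  refine ⟨steps (searchGuard.time + 1) ++ (steps ((Expr.eq (.reg 6) (.lit 0)).time + 1) ++
    (steps k ++ c)), steps k', ?_, ?_, ?_, ?_, k', ?_, rfl⟩
  · simp
  · simp [endSol_notMem_steps, hc2]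
  · rw [written_steps_append, written_steps_append, written_steps_append, hc3, elements,
      List.range_eq_range']
  · simp only [List.length_append, length_steps, outCost, iterCost]
    omega
  · unfold iterCost
    omega

/-- The search loop explores all completions of the partial labelling `f` and then undoes the last
choice. -/
def Explores (n W : ℕ) (par v : ℕ → ℕ) (i : ℕ) : Prop :=
  ∀ (f : ℕ → Fin 4) (s : State), s.Bounded W → Node n par v f i s → Alive n par v f i →
    s.reg 7 = 0 →
    ∃ tr s', Iterates W searchGuard searchBody s tr s' ∧ s'.Bounded W ∧
      Node n par v f (i + 1) s' ∧ s'.reg 7 = f (v i) + 1 ∧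
      Produces (gapCost n) (iterCost * (6 * i + 1)) (outCost n + iterCost * (6 * i))
        ((completions n par v i f).map (elements n)) tr

/-- Induction on the number `m` of labels left. An invalid label costs one iteration; a valid one
leads to at least one solution, so no time is lost in fruitless subtrees. If no label is valid, the
stretch is silent and is added to a neighbouring gap. -/
theorem scan (hW : 100 * (n + 1) ≤ W) (hW₁ : stateCoding.size ≤ W)
    (hW₂ : setCoding.size ≤ W) (hv : IsElimOrder n par v) (hi : i < n)
    (hE : Explores n W par v i) (m : ℕ) : ∀ (k : ℕ) (s : State), k + m = 4 → s.Bounded W →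
    Node n par v f (i + 1) s → Alive n par v f (i + 1) → s.reg 7 = k →
    ∃ tr s', Iterates W searchGuard searchBody s tr s' ∧ s'.Bounded W ∧
      Node n par v f (i + 1) s' ∧ s'.reg 7 = 4 ∧
      (solutionsFrom n par v f i k = [] → ∃ t ≤ iterCost * m, tr = steps t) ∧
      (solutionsFrom n par v f i k ≠ [] →
        Produces (gapCost n) (iterCost * (6 * i + 1 + m)) (outCost n + iterCost * (6 * i + m))
          (solutionsFrom n par v f i k) tr) := by
  induction m with
  | zero =>
    intro k s hk hb h hal h7
    obtain rfl : k = 4 := by omega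
    exact ⟨[], s, .refl s, hb, h, h7, fun _ => ⟨0, by omega, rfl⟩,
      fun hne => absurd solutionsFrom_four hne⟩
  | succ m ih =>
    intro k s hk hb h hal h7
    obtain ⟨k, rfl⟩ : ∃ l : Fin 4, k = l := ⟨⟨k, by omega⟩, rfl⟩
    obtain ⟨⟨t, ht, hit⟩, hb'⟩ := iterate_try hW hW₁ hW₂ hv hb h hi h7
    rw [solutionsFrom_succ]
    by_cases hval : ValidLabel n par v f i k
    · obtain ⟨hnode, h70⟩ := try_run_of_valid hv h hi h7 hval
      have hal' := IsElimOrder.Alive.update hv hi hal hval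
      obtain ⟨tr₁, s₁, hit₁, hb₁, hnode₁, h71, hP₁⟩ := hE _ _ hb' hnode hal' h70
      rw [Function.update_self] at h71
      obtain ⟨tr₂, s₂, hit₂, hb₂, hnode₂, h72, hP₂, hP₂'⟩ := ih (k + 1) s₁ (by omega) hb₁
        (hnode₁.congr hv (hv.update_eq hi f k)) hal h71
      rw [if_pos hval]
      have hne : (completions n par v i (Function.update f (v i) k)).map (elements n) ≠ [] := by
        rw [ne_eq, List.map_eq_nil_iff]
        exact hv.completions_ne_nil hi.le hal'
      refine ⟨_, s₂, hit.trans (hit₁.trans hit₂), hb₂, hnode₂, h72,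
        fun h => absurd (List.append_eq_nil_iff.1 h).1 hne, fun _ => ?_⟩
      have e₁ : outCost n + iterCost * (6 * i + (m + 1)) =
          iterCost + (outCost n + iterCost * (6 * i + m)) := by ring
      by_cases hn2 : solutionsFrom n par v f i (k + 1) = []
      · obtain ⟨t₂, ht₂, rfl⟩ := hP₂ hn2
        rw [hn2, List.append_nil]
        refine ((hP₁.append_steps t₂).steps_append hne t).mono ?_ ?_
        · rw [e₁]
          have : iterCost * (6 * i) ≤ iterCost * (6 * i + m) := Nat.mul_le_mul_left _ (by omega)
          omega
        · have : iterCost * (6 * i + 1 + (m + 1)) =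
            iterCost * (6 * i + 1) + iterCost * m + iterCost := by ring
          omega
      · refine ((hP₁.append hne (hP₂' hn2) hn2 ?_).steps_append (by simp [hn2]) t).mono ?_ ?_
        -- The largest gap: climbing out of one subtree, trying labels, descending into the next and
        -- writing its first solution.
        · have : iterCost * (6 * i + 1) + (outCost n + iterCost * (6 * i + m)) =
            outCost n + iterCost * (12 * i + 1 + m) := by ring
          rw [this, gapCost]
          exact Nat.add_le_add_left (Nat.mul_le_mul_left _ (by omega)) _
        · rw [e₁]
          have : iterCost * (6 * i) ≤ iterCost * (6 * i + m) := Nat.mul_le_mul_left _ (by omega)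
          omega
        · exact Nat.mul_le_mul_left _ (by omega)
    · obtain ⟨hnode, h70⟩ := try_run_of_not_valid hv h hi h7 hval
      obtain ⟨tr₂, s₂, hit₂, hb₂, hnode₂, h72, hP₂, hP₂'⟩ :=
        ih (k + 1) _ (by omega) hb' hnode hal h70
      rw [if_neg hval, List.nil_append]
      refine ⟨_, s₂, hit.trans hit₂, hb₂, hnode₂, h72, fun hn2 => ?_, fun hn2 => ?_⟩
      · obtain ⟨t₂, ht₂, rfl⟩ := hP₂ hn2
        refine ⟨t + t₂, ?_, steps_add _ _⟩
        rw [mul_add]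
        omega
      · refine ((hP₂' hn2).steps_append hn2 t).mono ?_ ?_
        · have e₁ : outCost n + iterCost * (6 * i + (m + 1)) =
            iterCost + (outCost n + iterCost * (6 * i + m)) := by ring
          omega
        · exact Nat.mul_le_mul_left _ (by omega)

/-- Each level adds at most four tries and one undoing step, so six iterations per level are more
than enough. -/
theorem explores (hW : 100 * (n + 1) ≤ W) (hW₁ : stateCoding.size ≤ W)
    (hW₂ : setCoding.size ≤ W) (hv : IsElimOrder n par v) (hi : i < n) :
    Explores n W par v i := by
  induction i with
  | zero =>
    intro f s hb h hal h7
    obtain ⟨tr, s', h1, h2, h3, h4, h5⟩ := iterate_out hW hv hb hi h (gapCost n)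
    exact ⟨tr, s', h1, h2, h3, h4, by simpa [completions] using h5⟩
  | succ i ih =>
    intro f s hb h hal h7
    obtain ⟨tr, s', h1, h2, h3, h4, -, h6⟩ :=
      scan hW hW₁ hW₂ hv (by omega) (ih (by omega)) 4 0 s rfl
      hb h hal h7
    have hne : (completions n par v (i + 1) f).map (elements n) ≠ [] := by
      rw [ne_eq, List.map_eq_nil_iff]
      exact hv.completions_ne_nil hi.le hal
    rw [solutionsFrom_zero] at h6
    obtain ⟨⟨t, ht, hit⟩, hb'⟩ := iterate_up hW hv h2 h3 hi (by omega) h4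
    obtain ⟨hnode, h7'⟩ := up_run hv h3 hi
    refine ⟨_, _, h1.trans hit, hb', hnode, h7', ((h6 hne).append_steps t).mono ?_ ?_⟩
    · exact Nat.add_le_add_left (Nat.mul_le_mul_left _ (by omega)) _
    · have : iterCost * (6 * (i + 1) + 1) = iterCost * (6 * i + 1 + 4) + iterCost * 2 := by ring
      omega

theorem search_loop (hW : 100 * (n + 1) ≤ W) (hW₁ : stateCoding.size ≤ W)
    (hW₂ : setCoding.size ≤ W) (hv : IsElimOrder n par v) (hn : 0 < n) (hb : s.Bounded W)
    (h : Node n par v f n s) (hal : Alive n par v f n) (h7 : s.reg 7 = 0) :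
    ∃ tr s', Exec W (.while searchGuard searchBody) s tr s' ∧
      Produces (gapCost n) (iterCost * (6 * n + 6)) (outCost n + iterCost * (6 * n + 6))
        ((completions n par v n f).map (elements n)) tr := by
  obtain ⟨i, rfl⟩ : ∃ i, n = i + 1 := ⟨n - 1, by omega⟩
  obtain ⟨tr, s', h1, h2, h3, h4, -, h6⟩ := scan hW hW₁ hW₂ hv (Nat.lt_succ_self i)
    (explores hW hW₁ hW₂ hv (Nat.lt_succ_self i)) 4 0 s rfl hb h hal h7
  have hne : (completions (i + 1) par v (i + 1) f).map (elements (i + 1)) ≠ [] := by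
    rw [ne_eq, List.map_eq_nil_iff]
    exact hv.completions_ne_nil le_rfl hal
  rw [solutionsFrom_zero] at h6
  have hfits := (searchGuard_ok (s := s') (by omega)).fits h2 (by omega : 2 ≤ W)
  refine ⟨_, s', h1.exec hfits (searchGuard_val_eq (by rw [h3.level, h3.reg0]) h4),
    ((h6 hne).append_steps _).mono ?_ ?_⟩
  · exact Nat.add_le_add_left (Nat.mul_le_mul_left _ (by omega)) _
  · have : iterCost * (6 * (i + 1) + 6) = iterCost * (6 * i + 1 + 4) + iterCost * 7 := by ring
    have : searchGuard.time + 1 ≤ iterCost := Nat.le_add_right _ _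
    omega

end TreeDom

namespace TreeDom

open WordRAM Codes

variable {n W : ℕ} {par dep v : ℕ → ℕ} {G : SimpleGraph (Fin n)} {L : List (Fin n × Fin n)}

/-! ### The initialization -/

/-- The edges as pairs of numbers. -/
def edgePairs (L : List (Fin n × Fin n)) : List (ℕ × ℕ) := L.map fun e => ((e.1 : ℕ), (e.2 : ℕ))

theorem length_flatMap_edges (L : List (Fin n × Fin n)) :
    (L.flatMap fun e => [(e.1 : ℕ), (e.2 : ℕ)]).length = 2 * L.length := by
  induction L with
  | nil => rfl
  | cons e L ih =>
    rw [List.flatMap_cons, List.length_append, ih, List.length_cons]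
    simp only [List.length_cons, List.length_nil]
    ring

theorem getD_flatMap_edges (L : List (Fin n × Fin n)) (i : ℕ) (hi : i < (edgePairs L).length) :
    (L.flatMap fun e => [(e.1 : ℕ), (e.2 : ℕ)]).getD (i * 2) 0 = (edgePairs L)[i].1 ∧
      (L.flatMap fun e => [(e.1 : ℕ), (e.2 : ℕ)]).getD (i * 2 + 1) 0 = (edgePairs L)[i].2 := by
  induction L generalizing i with
  | nil => simp [edgePairs] at hi
  | cons e L ih =>
    cases i with
    | zero => simp [edgePairs]
    | succ i =>
      have := ih i (by simpa [edgePairs] using hi)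
      simpa [edgePairs, show (i + 1) * 2 = i * 2 + 1 + 1 by ring] using this

theorem edgePairs_lt {e : ℕ × ℕ} (he : e ∈ edgePairs L) : e.1 < n ∧ e.2 < n := by
  obtain ⟨e, -, rfl⟩ := List.mem_map.1 he
  exact ⟨e.1.isLt, e.2.isLt⟩

theorem initState_bounded (hW : n < W) : (initState n L).Bounded W := by
  refine ⟨fun r => by simp only [initState]; omega, fun a => ?_⟩
  simp only [initState, List.getD_eq_getElem?_getD]
  rcases h : (n :: L.flatMap fun e => [(e.1 : ℕ), (e.2 : ℕ)])[a]? with _ | x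
  · rw [h, Option.getD_none]
    omega
  · rw [h, Option.getD_some]
    have := List.mem_of_getElem? h
    simp only [List.mem_cons, List.mem_flatMap, List.not_mem_nil, or_false] at this
    rcases this with rfl | ⟨e, -, rfl | rfl⟩ <;> omega

theorem init_run (hlen : L.length + 1 = n) :
    EdgeInv n (edgePairs L) (edgePairs L).length (initProg.run (initState n L)) := by
  have hmem : ∀ a, (initState n L).mem (a + 1) =
      (L.flatMap fun e => [(e.1 : ℕ), (e.2 : ℕ)]).getD a 0 := fun a => by simp [initState]
  have h0 : (initState n L).mem 0 = n := rfl
  have hreg : ∀ r, (initState n L).reg r = 0 := fun r => rfl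
  -- The input occupies `2 * n - 1` cells, and the arrays start at `2 * n`.
  have hzero : ∀ x j, (initState n L).mem (addr (2 * n) x j) = 0 := by
    intro x j
    simp only [initState, List.getD_eq_getElem?_getD]
    rw [List.getElem?_eq_none, Option.getD_none]
    rw [List.length_cons, length_flatMap_edges, addr]
    omega
  have hl : (edgePairs L).length = L.length := by simp [edgePairs]
  simp [initProg, Program.run, Expr.val, h0, ← two_mul]
  constructor
  · simp
  · simp
  · simp [hreg]
  · simp [hreg]
  · intro i hi
    have hne1 : ∀ y k, i * 2 + 1 ≠ addr (2 * n) y k := fun y k => by unfold addr; omega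
    have hne2 : ∀ y k, i * 2 + 2 ≠ addr (2 * n) y k := fun y k => by unfold addr; omega
    have := getD_flatMap_edges L i hi
    rw [← hmem, ← hmem] at this
    simpa [hne1, hne2] using this
  · intro x
    by_cases hx : x = 0 <;> simp [hx, hzero, hreg, nbrSum]
  · intro x
    by_cases hx : x = 0 <;> simp [hx, hzero, hreg, nbrSum]
  · intro x j hj hj'
    simp [hj', show j ≠ 0 by omega, show j ≠ 1 by omega, hzero]

theorem init_safe (hW : 100 * (n + 1) ≤ W) : initProg.Safe W (initState n L) := by
  have h0 : (initState n L).mem 0 = n := rfl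
  simp [initProg, Program.Safe, Program.run, Expr.Ok, Expr.val, h0]
  omega

theorem EdgeInv.elimInv (hn : 0 < n) (hG : G.IsParentFun par dep) (hL : G.IsEdgeList L) {s : State}
    (h : EdgeInv n (edgePairs L) 0 s) : ElimInv n par (Finset.range n) (2 * n)
      (Program.run (.seq (.assign 2 (.lit 0)) <| .assign 3 (.lit 0)) s) := by
  have h2 : s.reg 2 = (edgePairs L).length := h.measure
  have hdeg := h.deg
  have hsum := h.sum
  rw [h2, List.take_length] at hdeg hsum
  simp only [Program.run, Expr.val]
  constructor
  · simp [h.reg0]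
  · simp [h.reg1]
  · exact fun x hx => Finset.mem_range.1 hx
  · simp
  · simp
  · simp [h.reg5]
  · simp; omega
  · intro x hx
    have := hG.par_le x (Finset.mem_range.1 hx)
    rw [Finset.mem_range]
    omega
  · intro x hx
    have := nbrSum_edges hn hG hL (fun _ => 1) (Finset.mem_range.1 hx)
    exact (hdeg x).trans this
  · intro x hx
    have := nbrSum_edges hn hG hL id (Finset.mem_range.1 hx)
    exact (hsum x).trans this
  · intro x hx
    rw [Finset.mem_range] at hx
    refine (hdeg x).trans ?_
    rw [if_neg (by omega), zero_add, nbrSum, List.sum_eq_zero_iff]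
    intro y hy
    obtain ⟨e, he, rfl⟩ := List.mem_map.1 hy
    have := edgePairs_lt he
    rw [if_neg (by omega), if_neg (by omega), add_zero]
  · intro x hx hx0 _
    simp at hx0
    simp [hx0]
  · simp [hn.ne]
  · intro i hi
    simp [h.reg5] at hi
  · intro i hi
    simp [h.reg5] at hi
  · intro x j hj hj'
    exact h.zero x j (by omega) hj'

variable [Codes]

theorem ElimInv.combineInv {m : ℕ} {s : State} (h : ElimInv n par ∅ m s) :
    CombineInv n par (fun i => s.mem (addr (2 * n) i 2)) n
      (Program.run (.assign 2 (.lit 0)) s) := by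
  have h5 : s.reg 5 = n := by simpa using h.count
  have ho := h.order
  rw [h5] at ho
  simp only [Program.run, Expr.val]
  constructor
  · simp [h.reg0]
  · simp [h.reg1]
  · simp
  · exact fun i _ => rfl
  · exact fun i hi => (ho i hi).2.2.1
  · intro u
    simp [completable, setCoding.code_zero, h.zero u 4 le_rfl (by omega)]
  · intro i hi
    simp at hi
  · intro x j hj hj'
    exact h.zero x j (by omega) hj'

theorem CombineInv.node {s : State} (h : CombineInv n par v 0 s) :
    Node n par v (fun _ => 0) n
      (Program.run (.seq (.assign 6 (.reg 0)) <| .assign 7 (.lit 0)) s) := by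
  have h2 : s.reg 2 = n := h.measure
  have hdone := h.done
  have hsaved := h.saved
  rw [h2] at hdone hsaved
  simp only [Program.run, Expr.val]
  constructor
  · simp [h.reg0]
  · simp [h.reg1]
  · simp [h.reg0]
  · exact h.order
  · exact h.parent
  · exact fun u _ => hdone u
  · exact hsaved
  · rintro u (rfl | hu)
    · simp [vstate, stateCoding.code_zero, h.zero u 6 le_rfl (by omega)]
    · simp [labelled] at hu
  · intro j hj hjn
    omega
  · intro u hu
    simp [labelled] at hu

end TreeDom

/-! ### The listed sets -/

namespace TreeDom

open WordRAM Codes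

variable {n W : ℕ} {par dep v : ℕ → ℕ} {G : SimpleGraph (Fin n)} {L : List (Fin n × Fin n)}

theorem exists_isMinimalDominatingSet (G : SimpleGraph (Fin n)) :
    ∃ D, G.IsMinimalDominatingSet D := by
  have huniv : G.IsDominatingSet Finset.univ := fun b => ⟨b, Finset.mem_univ b, .inl rfl⟩
  obtain ⟨D, -, hD⟩ := exists_minimal_le_of_wellFoundedLT G.IsDominatingSet _ huniv
  exact ⟨D, hD.prop, fun D' hD' h => hD'.not_ge (hD.le_of_le h hD'.le)⟩

/-- The search can start because some minimal dominating set exists: its labelling is alive, hence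
so are its restrictions, down to the empty one. -/
theorem IsElimOrder.alive (hv : IsElimOrder n par v) (hG : G.IsParentFun par dep) :
    Alive n par v (fun _ => 0) n := by
  obtain ⟨D, hD⟩ := exists_isMinimalDominatingSet G
  obtain ⟨f, hf1, -, hf2⟩ := exists_labelling par D
  have hal : ∀ i ≤ n, Alive n par v f i := by
    intro i
    induction i with
    | zero => exact fun _ => (hv.alive_iff hG hf1).2 ⟨hD, hf2⟩
    | succ i ih => exact fun hi => IsElimOrder.Alive.succ hv hi (ih (by omega))
  intro u hu
  rw [hv.vstate_congr (g := f) hu fun w hw => by simp [labelled] at hw]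
  exact hal n le_rfl u hu

theorem toFinset_elements (f : ℕ → Fin 4) : (elements n f).toFinset = labelledSet n f := by
  ext w
  simp [elements, mem_labelledSet]

theorem lists_of_produces (hv : IsElimOrder n par v) (hG : G.IsParentFun par dep) {g b a : ℕ}
    {tr : List Event} (h : Produces g b a
      ((completions n par v n fun _ => 0).map (elements n)) tr) :
    Lists tr {A | ∃ D : Finset (Fin n),
      G.IsMinimalDominatingSet D ∧ A = D.map Fin.valEmbedding} := by
  have hal := hv.alive hG
  have hmap : ((completions n par v n fun _ => 0).map (elements n)).map List.toFinset =
      (completions n par v n fun _ => 0).map (labelledSet n) := by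
    rw [List.map_map]
    exact List.map_congr_left fun f _ => toFinset_elements f
  refine h.lists ?_ ?_ ?_
  · intro l hl
    obtain ⟨f, -, rfl⟩ := List.mem_map.1 hl
    exact List.nodup_range.filter _
  · rw [hmap]
    refine List.Nodup.map_on ?_ (hv.completions_nodup le_rfl _)
    intro f hf g hg hfg
    funext w
    by_cases hw : w < n
    · exact hv.alive_ext (hv.completions_alive le_rfl hal hf) (hv.completions_alive le_rfl hal hg)
        hfg w hw
    · rw [(hv.completions_agree le_rfl hf).2 w (by omega),
        (hv.completions_agree le_rfl hg).2 w (by omega)]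
  · intro A
    rw [hmap, List.mem_map]
    constructor
    · rintro ⟨f, hf, rfl⟩
      obtain ⟨D, hD⟩ := exists_eq_map_val (n := n) f
      exact ⟨D, ((hv.alive_iff hG hD).1 (hv.completions_alive le_rfl hal hf)).1, hD⟩
    · rintro ⟨D, hD, rfl⟩
      obtain ⟨f, hf1, hf2, hf3⟩ := exists_labelling par D
      refine ⟨f, hv.mem_completions ((hv.alive_iff hG hf1).2 ⟨hD, hf3⟩) le_rfl ?_ ?_, hf1⟩
      · intro w hw
        simp [labelled] at hw
      · intro w hw
        rw [hf2 w hw]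

/-! ### The whole program -/

/-- Since `n + 1 ≥ 2`, a constant factor is absorbed by the exponent. -/
theorem word_bound (hn : 0 < n) {K C : ℕ} (hC : K + 2 ≤ C) : K * (n + 1) ^ 2 ≤ (n + 1) ^ C := by
  calc K * (n + 1) ^ 2 ≤ 2 ^ K * (n + 1) ^ 2 := by gcongr; exact Nat.lt_two_pow_self.le
    _ ≤ (n + 1) ^ K * (n + 1) ^ 2 := by gcongr; omega
    _ = (n + 1) ^ (K + 2) := (pow_add _ _ _).symm
    _ ≤ (n + 1) ^ C := Nat.pow_le_pow_right (by omega) hC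

variable [Codes]

noncomputable def mainProg : Program :=
  .seq initProg <| .seq (.while edgeGuard edgeBody) <|
  .seq (.seq (.assign 2 (.lit 0)) <| .assign 3 (.lit 0)) <| .seq (.while indexGuard elimBody) <|
  .seq (.assign 2 (.lit 0)) <| .seq (.while indexGuard combineBody) <|
  .seq (.seq (.assign 6 (.reg 0)) <| .assign 7 (.lit 0)) <| .while searchGuard searchBody

/-- A bound for the time before the search, up to the factor `n`. -/
noncomputable def setupConst : ℕ :=
  initProg.cost + (edgeGuard.time + 1 + edgeBody.cost) +
  Program.cost (.seq (.assign 2 (.lit 0)) <| .assign 3 (.lit 0)) +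
  3 * (indexGuard.time + 1 + elimBody.cost) + Program.cost (.assign 2 (.lit 0)) +
  2 * (indexGuard.time + 1 + combineBody.cost) +
  Program.cost (.seq (.assign 6 (.reg 0)) <| .assign 7 (.lit 0))

theorem mainProg_exec (hn : 0 < n) (hW : 100 * (n + 1) ^ 2 ≤ W) (hW₁ : stateCoding.size ≤ W)
    (hW₂ : setCoding.size ≤ W) (hG : G.IsParentFun par dep) (hL : G.IsEdgeList L) :
    ∃ tr s, Exec W mainProg (initState n L) tr s ∧
      ∃ v, IsElimOrder n par v ∧
      Produces (gapCost n) (iterCost * (6 * n + 6))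
        (setupConst * n + (outCost n + iterCost * (6 * n + 6)))
        ((completions n par v n fun _ => 0).map (elements n)) tr := by
  have hW' : 100 * (n + 1) ≤ W := by nlinarith
  have h2W : 2 ≤ W := by omega
  have hlen := length_edges hn hG hL
  have hlen' : (edgePairs L).length + 1 = n := by simpa [edgePairs] using hlen
  obtain ⟨⟨k₁, hk₁, x₁⟩, b₁⟩ := (init_safe hW').silent h2W (initState_bounded (L := L) (by omega))
  obtain ⟨s₂, ⟨k₂, hk₂, x₂⟩, i₂, b₂⟩ := edge_loop hn hW hlen' (fun e he => edgePairs_lt he)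
    (init_run hlen) b₁
  obtain ⟨⟨k₃, hk₃, x₃⟩, b₃⟩ := Program.Safe.silent
    (p := .seq (.assign 2 (.lit 0)) <| .assign 3 (.lit 0))
    h2W b₂ ⟨by change 0 < W; omega, by change 0 < W; omega⟩
  obtain ⟨s₄, ⟨k₄, hk₄, x₄⟩, ⟨m, i₄⟩, b₄⟩ := elim_loop hW' hG (i₂.elimInv hn hG hL) b₃
  obtain ⟨⟨k₅, hk₅, x₅⟩, b₅⟩ := Program.Safe.silent (p := .assign 2 (.lit 0))
    h2W b₄ (by change 0 < W; omega)
  obtain ⟨s₆, ⟨k₆, hk₆, x₆⟩, i₆, b₆⟩ := combine_loop hW' hW₂ i₄.isElimOrder i₄.combineInv b₅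
  obtain ⟨⟨k₇, hk₇, x₇⟩, b₇⟩ := Program.Safe.silent
    (p := .seq (.assign 6 (.reg 0)) <| .assign 7 (.lit 0))
    h2W b₆ ⟨trivial, by change 0 < W; omega⟩
  have hal := i₄.isElimOrder.alive hG
  obtain ⟨tr, s, x₈, hP⟩ := search_loop hW' hW₁ hW₂ i₄.isElimOrder hn b₇ i₆.node hal
    (by simp [Program.run, Expr.val])
  refine ⟨_, s, .seq x₁ (.seq x₂ (.seq x₃ (.seq x₄ (.seq x₅ (.seq x₆ (.seq x₇ x₈)))))), _,
    i₄.isElimOrder, ?_⟩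
  have hne : ((completions n par (fun i => s₄.mem (addr (2 * n) i 2)) n fun _ => 0).map
      (elements n)) ≠ [] := by
    rw [ne_eq, List.map_eq_nil_iff]
    exact i₄.isElimOrder.completions_ne_nil le_rfl hal
  simp only [← List.append_assoc, steps_add]
  refine (hP.steps_append hne _).mono ?_ le_rfl
  have hc : ∀ c, c ≤ c * n := fun c => Nat.le_mul_of_pos_right c hn
  have e₁ := hc initProg.cost
  have e₃ := hc (Program.cost (.seq (.assign 2 (.lit 0)) <| .assign 3 (.lit 0)))
  have e₄ := hc (indexGuard.time + 1 + elimBody.cost)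
  have e₅ := hc (Program.cost (.assign 2 (.lit 0)))
  have e₆ := hc (indexGuard.time + 1 + combineBody.cost)
  have e₇ := hc (Program.cost (.seq (.assign 6 (.reg 0)) <| .assign 7 (.lit 0)))
  unfold setupConst
  generalize initProg.cost = c₁ at *
  generalize edgeGuard.time + 1 + edgeBody.cost = c₂ at *
  generalize Program.cost (.seq (.assign 2 (.lit 0)) <| .assign 3 (.lit 0)) = c₃ at *
  generalize indexGuard.time + 1 + elimBody.cost = c₄ at *
  generalize Program.cost (.assign 2 (.lit 0)) = c₅ at *
  generalize indexGuard.time + 1 + combineBody.cost = c₆ at *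
  generalize Program.cost (.seq (.assign 6 (.reg 0)) <| .assign 7 (.lit 0)) = c₇ at *
  -- The factors 3 and 2 come from `2 * n + 1 ≤ 3 * n` and `n + 1 ≤ 2 * n`.
  have : k₁ + k₂ + k₃ + k₄ + k₅ + k₆ + k₇ ≤
      (c₁ + c₂ + c₃ + 3 * c₄ + c₅ + 2 * c₆ + c₇) * n := by nlinarith
  omega

/-- The constant in the bounds for the setup time and the delay. -/
noncomputable def timeConst : ℕ :=
  setupConst + iterCost * 25 + 2 * (indexGuard.time + 1 + outBody.cost + 1)

theorem time_bounds (hn : 0 < n) :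
    setupConst * n + (outCost n + iterCost * (6 * n + 6)) ≤ timeConst * n ∧
      gapCost n ≤ timeConst * n := by
  have h1 := Nat.le_mul_of_pos_right iterCost hn
  have h2 := Nat.le_mul_of_pos_right (indexGuard.time + 1 + outBody.cost + 1) hn
  have h3 := Nat.zero_le (setupConst * n)
  unfold gapCost outCost timeConst
  generalize indexGuard.time + 1 + outBody.cost + 1 = c at *
  -- The longest gap needs `iterCost * (12 * n + 13) + c * (n + 1)`, and `n ≥ 1` gives `12 * n + 13
  -- ≤ 25 * n` and `n + 1 ≤ 2 * n`.
  constructor <;> nlinarith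

end TreeDom

open TreeDom in
theorem theorem2 :
    ∃ (P : WordRAM.Program) (C : ℕ),
      ∀ (n : ℕ) (G : SimpleGraph (Fin n)), G.IsTree →
        ∀ L : List (Fin n × Fin n), G.IsEdgeList L →
          ∃ (tr : List WordRAM.Event) (s : WordRAM.State),
            WordRAM.Exec ((n + 1) ^ C) P (WordRAM.initState n L) tr s ∧
            WordRAM.Lists tr
              {A | ∃ D : Finset (Fin n),
                G.IsMinimalDominatingSet D ∧ A = D.map Fin.valEmbedding} ∧
            WordRAM.SetupTimeLE tr (C * n) ∧
            WordRAM.DelayLE tr (C * n) := by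
  obtain ⟨codes⟩ := nonempty_codes
  -- The codes in the tables must fit into a word even for `n = 1`; hence the sizes of the codings
  -- enter the exponent.
  obtain ⟨K, hK⟩ : ∃ K, K = 100 + Codes.stateCoding.size + Codes.setCoding.size := ⟨_, rfl⟩
  refine ⟨mainProg, timeConst + (K + 2), fun n G hG L hL => ?_⟩
  have hn : 0 < n := (Classical.choice hG.connected.nonempty).pos
  obtain ⟨par, dep, hpar⟩ := hG.exists_isParentFun
  have hW : K * (n + 1) ^ 2 ≤ (n + 1) ^ (timeConst + (K + 2)) :=
    word_bound hn (Nat.le_add_left _ _)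
  have hsq : K ≤ K * (n + 1) ^ 2 := Nat.le_mul_of_pos_right _ (by positivity)
  obtain ⟨tr, s, hx, v, hv, hP⟩ := mainProg_exec hn
    (le_trans (Nat.mul_le_mul_right _ (by omega)) hW) (le_trans (by omega) (hsq.trans hW))
    (le_trans (by omega) (hsq.trans hW)) hpar hL
  have hne : (completions n par v n fun _ => 0).map (elements n) ≠ [] := by
    rw [ne_eq, List.map_eq_nil_iff]
    exact hv.completions_ne_nil le_rfl (hv.alive hpar)
  obtain ⟨ht₁, ht₂⟩ := time_bounds hn
  have hle : timeConst * n ≤ (timeConst + (K + 2)) * n :=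
    Nat.mul_le_mul_right _ (Nat.le_add_right _ _)
  refine ⟨tr, s, hx, lists_of_produces hv hpar hP, fun p hp => ?_, fun p hp => ?_⟩
  · exact (hP.setupTimeLE hne p hp).trans (ht₁.trans hle)
  · refine (hP.delayLE hne ?_ p hp).trans (ht₂.trans hle)
    -- `DelayLE` adds one unit to every later phase, also to the last one, which has no separator.
    have h1 : 1 ≤ iterCost := by unfold iterCost; omega
    unfold gapCost outCost
    nlinarith
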